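/- **Setting.** Let $\mathcal M=(\mathcal S,\mathcal A,P,r,\gamma)$ be a tabular discounted Markov decision process: a finite nonempty set $\mathcal S$ of states, finite nonempty action sets $\mathcal A_s$, the set $\mathcal A=\{(s,a):s\in\mathcal S,\ a\in\mathcal A_s\}$ with $A_{\rm tot}=|\mathcal A|$, rewards $r_a(s)\in[0,1]$, transition distributions $p_a(s)$ on $\mathcal S$ (the rows of $P\in[0,1]^{\mathcal A\times\mathcal S}$), and $\gamma\in[0,1)$. A policy is a map $\pi$ with $\pi(s)\in\mathcal A_s$; $v^\star(s)$ is the maximum over all policies of the expected discounted reward $\mathbb E[\sum_{t\ge0}\gamma^t r_t]$ from $s$; a policy $\pi^\star$ is optimal if it attains $v^\star(s)$ for every $s$; $P^\star$ is the $\mathcal S\times\mathcal S$ matrix with rows $p_{\pi^\star(s)}(s)^\top$; and $\mathcal T_\pi(u)(s)=r_{\pi(s)}(s)+\gamma\,p_{\pi(s)}(s)^\top u$. A generative model returns, for each query $(s,a)\in\mathcal A$, an independent sample of $p_a(s)$. Inequalities between vectors are entrywise, and $\mathbf 1$ is the all-ones vector. **Algorithm.** $\mathrm{TruncatedVRVI}(v^{(0)},\pi^{(0)},x,\alpha,\delta)$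 sets $L=\lceil \log(8)(1-\gamma)^{-1}\rceil$, $M=\lceil L\cdot 2^8\log(2A_{\rm tot}/\delta)\rceil$ and $g^{(1)}=\hat g^{(1)}=0\in\mathbb R^{\mathcal A}$. For $\ell=1,\dots,L$ it computes $\tilde Q=r+\gamma(x+\hat g^{(\ell)})$ and, for each state $s$, $\tilde v^{(\ell)}(s)=\min\{\max_{a\in\mathcal A_s}\tilde Q_{s,a},\ v^{(\ell-1)}(s)+(1-\gamma)\alpha\}$ and $\tilde\pi^{(\ell)}(s)\in\arg\max_{a\in\mathcal A_s}\tilde Q_{s,a}$ (any fixed rule selecting a maximizer from the values $(\tilde Q_{s,a})_{a\in\mathcal A_s}$). It sets $(v^{(\ell)}(s),\pi^{(\ell)}(s))$ to $(\tilde v^{(\ell)}(s),\tilde\pi^{(\ell)}(s))$ if $\tilde v^{(\ell)}(s)\ge v^{(\ell-1)}(s)$, and to $(v^{(\ell-1)}(s),\pi^{(\ell-1)}(s))$ otherwise. For each $(s,a)$ it then draws $M$ fresh independent samples $i_1,\dots,i_M$ from $p_a(s)$ and sets $g^{(\ell+1)}_a(s)=g^{(\ell)}_a(s)+\frac1M\sum_{n=1}^M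 (v^{(\ell)}-v^{(\ell-1)})(i_n)$ and $\hat g^{(\ell+1)}_a(s)=g^{(\ell+1)}_a(s)-\frac{(1-\gamma)\alpha}{8}$. It returns $(v^{(L)},\pi^{(L)})$. **Statement.** (i) Let $\delta\in(0,1)$, $\alpha\ge 0$ and $\beta\in\mathbb R^{\mathcal A}_{\ge0}$. Suppose that $Pv^{(0)}-\beta\le x\le Pv^{(0)}$, that $v^\star-\alpha\mathbf 1\le v^{(0)}\le v^\star$, and that $v^{(0)}\le\mathcal T_{\pi^{(0)}}(v^{(0)})$. Then, with probability at least $1-\delta$, the output $(v^{(L)},\pi^{(L)})$ of $\mathrm{TruncatedVRVI}(v^{(0)},\pi^{(0)},x,\alpha,\delta)$ satisfies $$0\le v^\star-v^{(L)}\le\gamma^L\alpha\,\mathbf 1+(I-\gamma P^\star)^{-1}\xi,\qquad \xi(s)=\gamma\Big(\frac{1-\gamma}{4}\alpha+\beta_{\pi^\star(s)}(s)\Big),$$ for every optimal policy $\pi^\star$, and $v^{(L)}\le\mathcal T_{\pi^{(L)}}(v^{(L)})$; and if $\beta=0$, then moreover $0\le v^\star-v^{(L)}\le\frac{\alpha}{2}\mathbf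 1$. (ii) The algorithm can be implemented with $A_{\rm tot}ML$ queries, $O(A_{\rm tot}ML)$ time and $O(A_{\rm tot})$ space. Precisely, there are an absolute constant $C$ and a single program for a real RAM with generative-model access (unit cost for the four arithmetic operations, $\log$ and comparisons on reals, for setting to constants, copying, incrementing and comparing indices, and for a query; $P$ is not part of the input) such that for every $\mathcal M$, for some rule of selecting maximizers, on all inputs with $\alpha\ge0$ and $\delta\in(0,1)$ and for all answers of the generative model the program halts, outputs exactly the result of $\mathrm{TruncatedVRVI}$ on these answers, makes at most $A_{\rm tot}ML$ queries, takes at most $C\,A_{\rm tot}ML$ steps, and accesses at most $C\,A_{\rm tot}$ memory cells. -/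

import Mathlib

open MeasureTheory ProbabilityTheory

noncomputable section

/-! Tabular discounted Markov decision processes -/

/-- A tabular discounted Markov decision process: finitely many states `0, …, numStates - 1`, at
state `s` the nonempty set of actions `0, …, numActions s - 1`, rewards in `[0,1]`, transition
distributions `trans s a` on the states, and a discount factor in `[0,1)`. -/
structure DMDP where
  numStates : ℕ
  numStates_pos : 0 < numStates
  numActions : Fin numStates → ℕ
  numActions_pos : ∀ s, 0 < numActions s
  reward : (s : Fin numStates) → Fin (numActions s) → ℝ
  reward_nonneg : ∀ s a, 0 ≤ reward s a
  reward_le_one : ∀ s a, reward s a ≤ 1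
  trans : (s : Fin numStates) → Fin (numActions s) → Fin numStates → ℝ
  trans_nonneg : ∀ s a t, 0 ≤ trans s a t
  trans_sum : ∀ s a, ∑ t, trans s a t = 1
  γ : ℝ
  γ_nonneg : 0 ≤ γ
  γ_lt_one : γ < 1

/-- `x` is an `α`-underestimate of `y`. -/
def IsUnderestimate {ι : Type*} (α : ℝ) (x y : ι → ℝ) : Prop :=
  0 ≤ α ∧ ∀ i, y i - α ≤ x i ∧ x i ≤ y i

namespace DMDP

variable (𝓜 : DMDP)

abbrev State : Type := Fin 𝓜.numStates

abbrev Action (s : 𝓜.State) : Type := Fin (𝓜.numActions s)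

/-- State-action pairs. -/
abbrev Pair : Type := (s : 𝓜.State) × 𝓜.Action s

/-- The number of state-action pairs. -/
def Atot : ℕ := ∑ s, 𝓜.numActions s

/-- Deterministic policies. -/
abbrev Policy : Type := (s : 𝓜.State) → 𝓜.Action s

/-- The vector `P u`, indexed by state-action pairs. -/
def utility (u : 𝓜.State → ℝ) (p : 𝓜.Pair) : ℝ := ∑ t, 𝓜.trans p.1 p.2 t * u t

/-- The value operator of the policy `π`. -/
def policyOp (π : 𝓜.Policy) (u : 𝓜.State → ℝ) (s : 𝓜.State) : ℝ :=
  𝓜.reward s (π s) + 𝓜.γ * 𝓜.utility u ⟨s, π s⟩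

/-- The transition matrix of the Markov chain of states under the policy `π`. -/
def policyMatrix (π : 𝓜.Policy) : Matrix 𝓜.State 𝓜.State ℝ :=
  Matrix.of fun s t => 𝓜.trans s (π s) t

/-- The expected discounted reward `E[∑ₜ γᵗ rₜ]` of the policy `π` started in `s`. The law of the
state at time `t` is the row `s` of the `t`-th power of the transition matrix, so that
`E[rₜ] = ((P^π)^t r^π)(s)`. -/
def policyValue (π : 𝓜.Policy) (s : 𝓜.State) : ℝ :=
  ∑' t : ℕ, 𝓜.γ ^ t * ((𝓜.policyMatrix π ^ t).mulVec fun u => 𝓜.reward u (π u)) s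

/-- The optimal value `v*`: the largest expected discounted reward of any policy. -/
def optimalValue (s : 𝓜.State) : ℝ := ⨆ π : 𝓜.Policy, 𝓜.policyValue π s

/-- `π` is an optimal policy: it attains the optimal value from every state. -/
def IsOptimalPolicy (π : 𝓜.Policy) : Prop := ∀ s, 𝓜.policyValue π s = 𝓜.optimalValue s

/-! The generative model and the algorithm -/

/-- The answers of a generative model: `ω p j` is the answer to the `j`-th query (from `j = 0`)
of the state-action pair `p`. -/
abbrev Tape : Type := 𝓜.Pair → ℕ → 𝓜.State

/-- The random answers `X` are mutually independent, each answer to a query of `(s, a)` being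
distributed according to the transition distribution of `(s, a)`. -/
structure IsGenerativeModel {Ω : Type*} [MeasurableSpace Ω] (μ : Measure Ω)
    (X : 𝓜.Pair → ℕ → Ω → 𝓜.State) : Prop where
  measurable : ∀ p j, Measurable (X p j)
  law : ∀ p j t, μ.real {ω | X p j ω = t} = 𝓜.trans p.1 p.2 t
  indep : iIndepFun (fun (q : 𝓜.Pair × ℕ) => X q.1 q.2) μ

/-- The estimate of `pᵀ u` from the `M` draws `i 0, …, i (M - 1)`, shifted down according to the
offset parameter `η`. The norm is the sup norm. -/
def sample (u : 𝓜.State → ℝ) (M : ℕ) (η : ℝ) (i : ℕ → 𝓜.State) : ℝ :=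
  let x := (1 / (M : ℝ)) * ∑ j ∈ Finset.range M, u (i j)
  let σ := (1 / (M : ℝ)) * (∑ j ∈ Finset.range M, u (i j) ^ 2) - x ^ 2
  x - Real.sqrt (2 * η * σ) - 4 * η ^ ((3 : ℝ) / 4) * ‖u‖ - (2 / 3) * η * ‖u‖

/-- `sample` for every state-action pair, with the draws `i p` for the pair `p`. -/
def apxUtility (u : 𝓜.State → ℝ) (M : ℕ) (η : ℝ) (i : 𝓜.Tape) (p : 𝓜.Pair) : ℝ :=
  𝓜.sample u M η (i p)

/-- A rule selecting, at every state, an action from given action values. -/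
abbrev SelectionRule : Type := (s : 𝓜.State) → (𝓜.Action s → ℝ) → 𝓜.Action s

/-- The rule always selects a maximizing action (with some way of breaking ties). -/
def IsArgmaxRule (am : 𝓜.SelectionRule) : Prop :=
  ∀ (s : 𝓜.State) (f : 𝓜.Action s → ℝ) (a : 𝓜.Action s), f a ≤ f (am s f)

/-- The number of iterations. -/
def iterCount : ℕ := ⌈Real.log 8 * (1 - 𝓜.γ)⁻¹⌉₊

/-- The number of samples per state-action pair and iteration. -/
def sampleCount (δ : ℝ) : ℕ :=
  ⌈(𝓜.iterCount : ℝ) * 2 ^ 8 * Real.log (2 * (𝓜.Atot : ℝ) / δ)⌉₊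

/-- The variables of `TruncatedVRVI` that survive from one iteration to the next. -/
structure Iterate where
  v : 𝓜.State → ℝ
  π : 𝓜.Policy
  g : 𝓜.Pair → ℝ
  gHat : 𝓜.Pair → ℝ

/-- One iteration of `TruncatedVRVI`. The iterations are numbered from `0`, and iteration `ℓ`
uses the draws `ℓ M, …, ℓ M + M - 1` of every state-action pair. -/
def iteration (am : 𝓜.SelectionRule) (x : 𝓜.Pair → ℝ) (α : ℝ) (M : ℕ) (ω : 𝓜.Tape)
    (ℓ : ℕ) (I : 𝓜.Iterate) : 𝓜.Iterate :=
  let Q : 𝓜.Pair → ℝ := fun p => 𝓜.reward p.1 p.2 + 𝓜.γ * (x p + I.gHat p)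
  let vTilde : 𝓜.State → ℝ := fun s =>
    min (⨆ a : 𝓜.Action s, Q ⟨s, a⟩) (I.v s + (1 - 𝓜.γ) * α)
  let πTilde : 𝓜.Policy := fun s => am s fun a => Q ⟨s, a⟩
  let v' : 𝓜.State → ℝ := fun s => if vTilde s ≥ I.v s then vTilde s else I.v s
  let π' : 𝓜.Policy := fun s => if vTilde s ≥ I.v s then πTilde s else I.π s
  let Δ : 𝓜.Pair → ℝ := 𝓜.apxUtility (v' - I.v) M 0 fun p j => ω p (ℓ * M + j)
  let g' : 𝓜.Pair → ℝ := I.g + Δ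
  { v := v', π := π', g := g', gHat := fun p => g' p - (1 - 𝓜.γ) * α / 8 }

/-- The state of `TruncatedVRVI` after `ℓ` iterations. -/
def iterates (am : 𝓜.SelectionRule) (v₀ : 𝓜.State → ℝ) (π₀ : 𝓜.Policy) (x : 𝓜.Pair → ℝ)
    (α : ℝ) (M : ℕ) (ω : 𝓜.Tape) : ℕ → 𝓜.Iterate
  | 0 => { v := v₀, π := π₀, g := 0, gHat := 0 }
  | ℓ + 1 => 𝓜.iteration am x α M ω ℓ (iterates am v₀ π₀ x α M ω ℓ)

/-- The algorithm `TruncatedVRVI`, returning a value vector and a policy. -/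
def truncatedVRVI (am : 𝓜.SelectionRule) (v₀ : 𝓜.State → ℝ) (π₀ : 𝓜.Policy)
    (x : 𝓜.Pair → ℝ) (α δ : ℝ) (ω : 𝓜.Tape) : (𝓜.State → ℝ) × 𝓜.Policy :=
  let I := 𝓜.iterates am v₀ π₀ x α (𝓜.sampleCount δ) ω 𝓜.iterCount
  (I.v, I.π)

end DMDP

/-! A real RAM with access to a generative model.

The memory consists of arrays of natural numbers (indices) and arrays of reals; the arrays are
numbered. Natural numbers can only be set to constants, copied, incremented and compared, so that
along a run they stay bounded by inputs, constants of the program, oracle answers and the running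
time. Reals are subject to the four arithmetic operations, the logarithm and comparison. -/

namespace RealRAM

/-- Memory cells: the position `i` of the index array or real array number `a`. -/
inductive Cell where
  | idx (a i : ℕ)
  | real (a i : ℕ)
deriving DecidableEq

/-- References in programs: `scalar a` is the position `0` of the array `a`, and `entry a i` is
the position of the array `a` that is stored in the scalar index variable `i`. -/
inductive Ref where
  | scalar (a : ℕ)
  | entry (a i : ℕ)

inductive ROp where
  | add
  | sub
  | mul
  | div

/-- Elementary instructions; the first reference is the destination. The instruction
`query d s a` queries the generative model with the state and action that are stored in `s` and
`a`, and stores the answer in `d`. -/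
inductive Instr where
  | iConst (d : Ref) (c : ℕ)
  | iCopy (d s : Ref)
  | iSucc (d : Ref)
  | rConst (d : Ref) (c : ℕ)
  | rCopy (d s : Ref)
  | rOp (o : ROp) (d s t : Ref)
  | rLog (d s : Ref)
  | query (d s a : Ref)

/-- Strict comparisons of two index cells or of two real cells. -/
inductive Test where
  | iLt (s t : Ref)
  | rLt (s t : Ref)

/-- Programs. -/
inductive Prog where
  | instr (c : Instr)
  | seq (p q : Prog)
  | cond (b : Test) (p q : Prog)
  | loop (b : Test) (p : Prog)

/-- Configurations: the memory, how often each state-action pair has been queried, and the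
resources used so far (number of steps, number of queries, set of memory cells accessed). -/
structure Config where
  idx : ℕ → ℕ → ℕ
  real : ℕ → ℕ → ℝ
  asked : ℕ → ℕ → ℕ
  time : ℕ
  queries : ℕ
  touched : Finset Cell

/-- The position that a reference denotes, within its array. -/
def Ref.pos (σ : Config) : Ref → ℕ
  | .scalar _ => 0
  | .entry _ i => σ.idx i 0

def Ref.arr : Ref → ℕ
  | .scalar a => a
  | .entry a _ => a

/-- The index cells that are read in order to find the position. -/
def Ref.aux : Ref → Finset Cell
  | .scalar _ => ∅
  | .entry _ i => {Cell.idx i 0}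

/-- The cells accessed through a reference to an index. -/
def Ref.iCells (σ : Config) (r : Ref) : Finset Cell := insert (Cell.idx r.arr (r.pos σ)) r.aux

/-- The cells accessed through a reference to a real. -/
def Ref.rCells (σ : Config) (r : Ref) : Finset Cell := insert (Cell.real r.arr (r.pos σ)) r.aux

def Ref.iVal (σ : Config) (r : Ref) : ℕ := σ.idx r.arr (r.pos σ)

def Ref.rVal (σ : Config) (r : Ref) : ℝ := σ.real r.arr (r.pos σ)

def ROp.eval : ROp → ℝ → ℝ → ℝ
  | .add, x, y => x + y
  | .sub, x, y => x - y
  | .mul, x, y => x * y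
  | .div, x, y => x / y

/-- Replace one value of a doubly indexed family. -/
def update₂ {β : Type} (f : ℕ → ℕ → β) (a i : ℕ) (y : β) : ℕ → ℕ → β :=
  Function.update f a (Function.update (f a) i y)

def Config.setIdx (σ : Config) (d : Ref) (y : ℕ) : Config :=
  { σ with idx := update₂ σ.idx d.arr (d.pos σ) y }

def Config.setReal (σ : Config) (d : Ref) (y : ℝ) : Config :=
  { σ with real := update₂ σ.real d.arr (d.pos σ) y }

/-- Charge one step and the access to the given cells. -/
def Config.charge (σ : Config) (cells : Finset Cell) : Config :=
  { σ with time := σ.time + 1, touched := σ.touched ∪ cells }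

/-- The cells accessed by an instruction. -/
def Instr.cells (σ : Config) : Instr → Finset Cell
  | .iConst d _ => d.iCells σ
  | .iCopy d s => d.iCells σ ∪ s.iCells σ
  | .iSucc d => d.iCells σ
  | .rConst d _ => d.rCells σ
  | .rCopy d s => d.rCells σ ∪ s.rCells σ
  | .rOp _ d s t => d.rCells σ ∪ s.rCells σ ∪ t.rCells σ
  | .rLog d s => d.rCells σ ∪ s.rCells σ
  | .query d s a => d.iCells σ ∪ s.iCells σ ∪ a.iCells σ

/-- The effect of an instruction, apart from the charge. The answer to the `j`-th query of the
state `s` and action `a` is `O s a j`. -/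
def Instr.effect (O : ℕ → ℕ → ℕ → ℕ) (σ : Config) : Instr → Config
  | .iConst d c => σ.setIdx d c
  | .iCopy d s => σ.setIdx d (s.iVal σ)
  | .iSucc d => σ.setIdx d (d.iVal σ + 1)
  | .rConst d c => σ.setReal d (c : ℝ)
  | .rCopy d s => σ.setReal d (s.rVal σ)
  | .rOp o d s t => σ.setReal d (o.eval (s.rVal σ) (t.rVal σ))
  | .rLog d s => σ.setReal d (Real.log (s.rVal σ))
  | .query d s a =>
    { σ.setIdx d (O (s.iVal σ) (a.iVal σ) (σ.asked (s.iVal σ) (a.iVal σ))) with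
      asked := update₂ σ.asked (s.iVal σ) (a.iVal σ) (σ.asked (s.iVal σ) (a.iVal σ) + 1)
      queries := σ.queries + 1 }

def Instr.step (O : ℕ → ℕ → ℕ → ℕ) (σ : Config) (c : Instr) : Config :=
  (c.effect O σ).charge (c.cells σ)

def Test.holds (σ : Config) : Test → Prop
  | .iLt s t => s.iVal σ < t.iVal σ
  | .rLt s t => s.rVal σ < t.rVal σ

def Test.cells (σ : Config) : Test → Finset Cell
  | .iLt s t => s.iCells σ ∪ t.iCells σ
  | .rLt s t => s.rCells σ ∪ t.rCells σ

/-- `Exec O p σ σ'`: with the oracle answers `O`, the program `p` started in `σ` halts in `σ'`.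
Every instruction and every evaluation of a test takes one step. -/
inductive Exec (O : ℕ → ℕ → ℕ → ℕ) : Prog → Config → Config → Prop where
  | instr (c : Instr) (σ : Config) : Exec O (.instr c) σ (c.step O σ)
  | seq {p q : Prog} {σ σ₁ σ₂ : Config} :
      Exec O p σ σ₁ → Exec O q σ₁ σ₂ → Exec O (.seq p q) σ σ₂
  | cond_true {b : Test} {p q : Prog} {σ σ₁ : Config} :
      b.holds σ → Exec O p (σ.charge (b.cells σ)) σ₁ → Exec O (.cond b p q) σ σ₁
  | cond_false {b : Test} {p q : Prog} {σ σ₁ : Config} :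
      ¬ b.holds σ → Exec O q (σ.charge (b.cells σ)) σ₁ → Exec O (.cond b p q) σ σ₁
  | loop_true {b : Test} {p : Prog} {σ σ₁ σ₂ : Config} :
      b.holds σ → Exec O p (σ.charge (b.cells σ)) σ₁ → Exec O (.loop b p) σ₁ σ₂ →
        Exec O (.loop b p) σ σ₂
  | loop_false {b : Test} {p : Prog} {σ : Config} :
      ¬ b.holds σ → Exec O (.loop b p) σ (σ.charge (b.cells σ))

end RealRAM

namespace DMDP

variable (𝓜 : DMDP)

/-- The oracle of the machine that answers queries according to `ω` (and queries of things that
are not state-action pairs by `0`). -/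
def oracle (ω : 𝓜.Tape) (s a j : ℕ) : ℕ :=
  if h : ∃ hs : s < 𝓜.numStates, a < 𝓜.numActions ⟨s, hs⟩ then
    (ω ⟨⟨s, h.1⟩, ⟨a, h.2⟩⟩ j : ℕ)
  else 0

/-- The array of length `k` with entries `f`, followed by zeros. -/
def toArray {β : Type} [Zero β] {k : ℕ} (f : Fin k → β) (i : ℕ) : β :=
  if h : i < k then f ⟨i, h⟩ else 0

/-- A vector indexed by the state-action pairs as an array: the pairs are listed state by state,
so that `(s, a)` is at position `(∑ s' < s, numActions s') + a`. -/
def pairArray (f : 𝓜.Pair → ℝ) : ℕ → ℝ :=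
  toArray fun j : Fin (∑ s, 𝓜.numActions s) => f (finSigmaFinEquiv.symm j)

/-- The start configuration of the machine for the inputs of `TruncatedVRVI`: the index arrays
`0`, `1`, `2` hold the number of states, the numbers of actions, and `π₀`; the real arrays
`0`, …, `5` hold `γ`, `α`, `δ`, `v₀`, the rewards, and `x`. The transition distributions are not
part of the input. -/
def startConfig (v₀ : 𝓜.State → ℝ) (π₀ : 𝓜.Policy) (x : 𝓜.Pair → ℝ) (α δ : ℝ) :
    RealRAM.Config where
  idx
    | 0 => fun i => if i = 0 then 𝓜.numStates else 0
    | 1 => toArray 𝓜.numActions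
    | 2 => toArray fun s => (π₀ s : ℕ)
    | _ => fun _ => 0
  real
    | 0 => fun i => if i = 0 then 𝓜.γ else 0
    | 1 => fun i => if i = 0 then α else 0
    | 2 => fun i => if i = 0 then δ else 0
    | 3 => toArray v₀
    | 4 => 𝓜.pairArray fun p => 𝓜.reward p.1 p.2
    | 5 => 𝓜.pairArray x
    | _ => fun _ => 0
  asked := fun _ _ => 0
  time := 0
  queries := 0
  touched := ∅

/-- The machine's output: the real array `3` holds `v` and the index array `2` holds `π`. -/
def IsOutput (σ : RealRAM.Config) (v : 𝓜.State → ℝ) (π : 𝓜.Policy) : Prop :=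
  ∀ s : 𝓜.State, σ.real 3 s = v s ∧ σ.idx 2 s = π s

end DMDP

end

noncomputable section

namespace DMDP

variable (𝓜 : DMDP)

/-! Accuracy. Randomness enters only through the event `IsAccurate`: before each iteration the
accumulated estimate `g` is within `(1 - γ) α / 8` of `P (v - v₀)`. Shifting `g` down by that amount
makes the error one-sided, so every action value lies between the exact Bellman backup minus `ξ` and
the backup itself (`actionValue_mem`). The upper side preserves `v ≤ T_π v`, hence `v ≤ v^π ≤ v*`
(`iterates_v_le_policyOp`). The lower side gives a contraction towards `v*` whose accumulated error
is the resolvent of `ξ`; truncation does no harm, because a truncated step gains at least what the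
contraction asks for (`optimalValue_sub_iterates_le`).

Concentration. The error of `g` is a sum of errors of sample means of increments (`sum_stepError`).
Truncation confines each increment to `[0, (1 - γ) α]`, and it is determined by earlier answers, so
Hoeffding's bound applies conditionally on the past and yields an exponential supermartingale
(`IsGenerativeModel.integral_stoppedExp_le_one`). Stopping it at a level `K` covers all iterations
with a single use of Markov's inequality; the union bound is only over pairs and two signs
(`IsGenerativeModel.measureReal_not_isAccurate_le`).

Implementation. An explicit program is verified with triples `Spec` that carry the arrays changed,
the queries, the steps and the cells accessed. Only `g` and one scalar shift are stored instead of
two vectors. An iteration takes a number of steps of order `M Atot`, and the setup, which counts up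
to `L` and `M` in order to round, is absorbed (`program_spec`). -/

instance : Nonempty 𝓜.State := ⟨⟨0, 𝓜.numStates_pos⟩⟩

instance (s : 𝓜.State) : Nonempty (𝓜.Action s) := ⟨⟨0, 𝓜.numActions_pos s⟩⟩

/-! Values of policies -/

lemma utility_mono {u w : 𝓜.State → ℝ} (h : ∀ s, u s ≤ w s) (p : 𝓜.Pair) :
    𝓜.utility u p ≤ 𝓜.utility w p :=
  Finset.sum_le_sum fun t _ => mul_le_mul_of_nonneg_left (h t) (𝓜.trans_nonneg _ _ _)

lemma utility_sub (u w : 𝓜.State → ℝ) (p : 𝓜.Pair) :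
    𝓜.utility (u - w) p = 𝓜.utility u p - 𝓜.utility w p := by
  simp [utility, mul_sub, Finset.sum_sub_distrib]

lemma utility_add (u w : 𝓜.State → ℝ) (p : 𝓜.Pair) :
    𝓜.utility (u + w) p = 𝓜.utility u p + 𝓜.utility w p := by
  simp [utility, mul_add, Finset.sum_add_distrib]

lemma utility_const (c : ℝ) (p : 𝓜.Pair) : 𝓜.utility (fun _ => c) p = c := by
  simp [utility, ← Finset.sum_mul, 𝓜.trans_sum]

lemma policyOp_sub (π : 𝓜.Policy) (u w : 𝓜.State → ℝ) (s : 𝓜.State) :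
    𝓜.policyOp π u s - 𝓜.policyOp π w s = 𝓜.γ * 𝓜.utility (u - w) ⟨s, π s⟩ := by
  simp only [policyOp, utility_sub]; ring

/-- A vector that is dominated by its own discounted expectation is nonpositive. -/
lemma nonpos_of_le_discounted (π : 𝓜.Policy) (d : 𝓜.State → ℝ)
    (h : ∀ s, d s ≤ 𝓜.γ * 𝓜.utility d ⟨s, π s⟩) (s : 𝓜.State) : d s ≤ 0 := by
  -- Maximum principle: at a state where `d` is largest, averaging cannot increase it, so `d m ≤ γ d
  -- m`, which forces `d m ≤ 0` because `γ < 1`.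
  obtain ⟨m, hm⟩ := Finite.exists_max d
  have h1 : 𝓜.utility d ⟨m, π m⟩ ≤ d m := by
    simpa [utility_const] using 𝓜.utility_mono (w := fun _ => d m) hm ⟨m, π m⟩
  have h2 := h m
  have h3 := mul_le_mul_of_nonneg_left h1 𝓜.γ_nonneg
  have h4 := 𝓜.γ_lt_one
  have : d m ≤ 0 := by nlinarith
  exact (hm s).trans this

lemma policyMatrix_mulVec (π : 𝓜.Policy) (u : 𝓜.State → ℝ) (s : 𝓜.State) :
    (𝓜.policyMatrix π).mulVec u s = 𝓜.utility u ⟨s, π s⟩ := rfl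

lemma policyMatrix_pow_mulVec_mem (π : 𝓜.Policy) (t : ℕ) (s : 𝓜.State) :
    0 ≤ ((𝓜.policyMatrix π ^ t).mulVec fun u => 𝓜.reward u (π u)) s ∧
      ((𝓜.policyMatrix π ^ t).mulVec fun u => 𝓜.reward u (π u)) s ≤ 1 := by
  induction t generalizing s with
  | zero => simp [𝓜.reward_nonneg, 𝓜.reward_le_one]
  | succ t ih =>
    rw [pow_succ', ← Matrix.mulVec_mulVec, policyMatrix_mulVec]
    constructor
    · simpa [utility_const] using
        𝓜.utility_mono (u := fun _ => 0) (fun s => (ih s).1) ⟨s, π s⟩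
    · simpa [utility_const] using
        𝓜.utility_mono (w := fun _ => 1) (fun s => (ih s).2) ⟨s, π s⟩

lemma summable_policyValue (π : 𝓜.Policy) (s : 𝓜.State) :
    Summable fun t : ℕ =>
      𝓜.γ ^ t * ((𝓜.policyMatrix π ^ t).mulVec fun u => 𝓜.reward u (π u)) s := by
  refine Summable.of_nonneg_of_le (fun t => ?_) (fun t => ?_)
    (summable_geometric_of_lt_one 𝓜.γ_nonneg 𝓜.γ_lt_one)
  · exact mul_nonneg (pow_nonneg 𝓜.γ_nonneg _) (𝓜.policyMatrix_pow_mulVec_mem π t s).1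
  · exact mul_le_of_le_one_right (pow_nonneg 𝓜.γ_nonneg _)
      (𝓜.policyMatrix_pow_mulVec_mem π t s).2

/-- The Bellman equation of a policy. -/
lemma policyValue_eq (π : 𝓜.Policy) (s : 𝓜.State) :
    𝓜.policyValue π s = 𝓜.policyOp π (𝓜.policyValue π) s := by
  have h1 := (𝓜.summable_policyValue π s).tsum_eq_zero_add
  rw [policyValue, h1]
  simp only [policyOp, utility, policyValue]
  congr 1
  · simp
  -- The tail of the series is one transition followed by the discounted sum from the next state;
  -- the finite sum over next states is exchanged with the series.
  · rw [← Finset.sum_congr rfl fun t _ => tsum_mul_left,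
      ← Summable.tsum_finsetSum fun t _ => (𝓜.summable_policyValue π t).mul_left _,
      ← tsum_mul_left]
    refine tsum_congr fun t => ?_
    rw [pow_succ' (𝓜.policyMatrix π), ← Matrix.mulVec_mulVec, policyMatrix_mulVec, utility,
      Finset.mul_sum, Finset.mul_sum]
    refine Finset.sum_congr rfl fun i _ => ?_
    ring

/-- By the Bellman equation, `u - v^π` is dominated by its own discounted expectation. This is how
the invariant `v ≤ T_π v` turns into an upper bound on the iterates. -/
lemma le_policyValue {π : 𝓜.Policy} {u : 𝓜.State → ℝ} (h : ∀ s, u s ≤ 𝓜.policyOp π u s)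
    (s : 𝓜.State) : u s ≤ 𝓜.policyValue π s := by
  have := 𝓜.nonpos_of_le_discounted π (u - 𝓜.policyValue π) (fun s => by
    rw [← policyOp_sub, ← policyValue_eq]
    simpa using h s) s
  simpa using this

lemma policyValue_le {π : 𝓜.Policy} {u : 𝓜.State → ℝ} (h : ∀ s, 𝓜.policyOp π u s ≤ u s)
    (s : 𝓜.State) : 𝓜.policyValue π s ≤ u s := by
  have := 𝓜.nonpos_of_le_discounted π (𝓜.policyValue π - u) (fun s => by
    rw [← policyOp_sub, ← policyValue_eq]
    have := h s
    simp only [Pi.sub_apply]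
    linarith) s
  simpa using this

lemma policyValue_le_optimalValue (π : 𝓜.Policy) (s : 𝓜.State) :
    𝓜.policyValue π s ≤ 𝓜.optimalValue s :=
  le_ciSup (f := fun π : 𝓜.Policy => 𝓜.policyValue π s) (Set.finite_range _).bddAbove π

/-- Take a policy with the largest sum of values over all states. Its greedy improvement is nowhere
worse, hence has the same value at every state by maximality. So its value dominates its own backup
under any other policy, and therefore that policy's value. -/
lemma exists_isOptimalPolicy : ∃ π, 𝓜.IsOptimalPolicy π := by
  obtain ⟨π, hπ⟩ := Finite.exists_max fun π : 𝓜.Policy => ∑ s, 𝓜.policyValue π s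
  choose π' hπ' using fun s => Finite.exists_max fun a : 𝓜.Action s =>
    𝓜.reward s a + 𝓜.γ * 𝓜.utility (𝓜.policyValue π) ⟨s, a⟩
  have h1 : ∀ s, 𝓜.policyValue π s ≤ 𝓜.policyValue π' s := 𝓜.le_policyValue fun s => by
    rw [𝓜.policyValue_eq π s]
    exact hπ' s (π s)
  have h2 : ∀ s, 𝓜.policyValue π s = 𝓜.policyValue π' s := fun s =>
    (Finset.sum_eq_sum_iff_of_le fun s _ => h1 s).1
      (le_antisymm (Finset.sum_le_sum fun s _ => h1 s) (hπ π')) s (Finset.mem_univ s)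
  refine ⟨π, fun s => le_antisymm (𝓜.policyValue_le_optimalValue π s) (ciSup_le fun ρ => ?_)⟩
  refine 𝓜.policyValue_le (fun s => ?_) s
  refine (hπ' s (ρ s)).trans (le_of_eq ?_)
  have h3 := 𝓜.policyValue_eq π' s
  rwa [← funext h2, eq_comm] at h3

lemma IsOptimalPolicy.policyOp_eq {𝓜 : DMDP} {π : 𝓜.Policy} (h : 𝓜.IsOptimalPolicy π)
    (s : 𝓜.State) : 𝓜.optimalValue s = 𝓜.policyOp π 𝓜.optimalValue s := by
  have := 𝓜.policyValue_eq π s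
  rwa [funext h] at this

/-! The resolvent of a policy -/

/-- The maximum principle, used in both directions, makes `1 - γ P^π` injective. Being square, it is
invertible, and multiplying the inverse by the matrix gives this fixed-point equation. Later
arguments about the resolvent use nothing else. -/
lemma resolvent_eq (π : 𝓜.Policy) (ξ : 𝓜.State → ℝ) (s : 𝓜.State) :
    ((1 - 𝓜.γ • 𝓜.policyMatrix π)⁻¹.mulVec ξ) s =
      ξ s + 𝓜.γ * 𝓜.utility ((1 - 𝓜.γ • 𝓜.policyMatrix π)⁻¹.mulVec ξ) ⟨s, π s⟩ := by
  set A := 1 - 𝓜.γ • 𝓜.policyMatrix π with hA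
  have key : ∀ u s, A.mulVec u s = u s - 𝓜.γ * 𝓜.utility u ⟨s, π s⟩ := fun u s => by
    simp [hA, Matrix.sub_mulVec, Matrix.smul_mulVec, policyMatrix_mulVec]
  have inj : Function.Injective A.mulVec := fun u w huw => by
    have h1 : ∀ u w : 𝓜.State → ℝ, A.mulVec u = A.mulVec w → ∀ s, u s ≤ w s := fun u w huw s => by
      have := 𝓜.nonpos_of_le_discounted π (u - w) (fun s => by
        have := congrFun huw s
        rw [key, key] at this
        rw [utility_sub, Pi.sub_apply]; linarith) s
      simpa using this
    exact funext fun s => le_antisymm (h1 u w huw s) (h1 w u huw.symm s)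
  have unit : IsUnit A.det :=
    (Matrix.isUnit_iff_isUnit_det A).1 (Matrix.mulVec_injective_iff_isUnit.1 inj)
  have h2 := key (A⁻¹.mulVec ξ) s
  rw [Matrix.mulVec_mulVec, Matrix.mul_nonsing_inv A unit, Matrix.one_mulVec] at h2
  linarith

lemma resolvent_nonneg (π : 𝓜.Policy) {ξ : 𝓜.State → ℝ} (hξ : ∀ s, 0 ≤ ξ s) (s : 𝓜.State) :
    0 ≤ ((1 - 𝓜.γ • 𝓜.policyMatrix π)⁻¹.mulVec ξ) s := by
  set w := (1 - 𝓜.γ • 𝓜.policyMatrix π)⁻¹.mulVec ξ with hw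
  have := 𝓜.nonpos_of_le_discounted π ((fun _ => 0) - w) (fun s => by
    have h1 := 𝓜.resolvent_eq π ξ s
    rw [← hw] at h1
    rw [utility_sub, utility_const, Pi.sub_apply]
    linarith [hξ s]) s
  simpa using this

/-- The constant vector `K` solves `K = (1 - γ) K + γ K`, so comparison with the fixed-point
equation bounds the resolvent. -/
lemma resolvent_le_const (π : 𝓜.Policy) {ξ : 𝓜.State → ℝ} {K : ℝ}
    (hξ : ∀ s, ξ s ≤ (1 - 𝓜.γ) * K) (s : 𝓜.State) :
    ((1 - 𝓜.γ • 𝓜.policyMatrix π)⁻¹.mulVec ξ) s ≤ K := by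
  set w := (1 - 𝓜.γ • 𝓜.policyMatrix π)⁻¹.mulVec ξ with hw
  have := 𝓜.nonpos_of_le_discounted π (w - fun _ => K) (fun s => by
    have h1 := 𝓜.resolvent_eq π ξ s
    rw [← hw] at h1
    rw [utility_sub, utility_const, Pi.sub_apply]
    linarith [hξ s]) s
  simpa using this

/-! The iterates of the algorithm -/

lemma sample_zero (u : 𝓜.State → ℝ) (M : ℕ) (i : ℕ → 𝓜.State) :
    𝓜.sample u M 0 i = (1 / (M : ℝ)) * ∑ j ∈ Finset.range M, u (i j) := by
  simp [sample]

/-- Combine `γ ≤ exp (-(1 - γ))` with `L (1 - γ) ≥ log 8`. -/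
lemma pow_iterCount_le : 𝓜.γ ^ 𝓜.iterCount ≤ 1 / 8 := by
  have h0 : 0 < 1 - 𝓜.γ := by linarith [𝓜.γ_lt_one]
  have h1 : 𝓜.γ ≤ Real.exp (-(1 - 𝓜.γ)) := by
    linarith [Real.add_one_le_exp (-(1 - 𝓜.γ))]
  have h2 : Real.log 8 ≤ 𝓜.iterCount * (1 - 𝓜.γ) := by
    have := Nat.le_ceil (Real.log 8 * (1 - 𝓜.γ)⁻¹)
    rwa [← div_eq_mul_inv, div_le_iff₀ h0, div_eq_mul_inv] at this
  calc 𝓜.γ ^ 𝓜.iterCount ≤ Real.exp (-(1 - 𝓜.γ)) ^ 𝓜.iterCount :=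
        pow_le_pow_left₀ 𝓜.γ_nonneg h1 _
    _ = Real.exp (-(𝓜.iterCount * (1 - 𝓜.γ))) := by rw [← Real.exp_nat_mul]; ring_nf
    _ ≤ Real.exp (-Real.log 8) := Real.exp_le_exp.2 (neg_le_neg h2)
    _ = 1 / 8 := by rw [Real.exp_neg, Real.exp_log (by norm_num)]; norm_num

lemma iterCount_pos : 0 < 𝓜.iterCount := by
  rw [iterCount, Nat.ceil_pos]
  exact mul_pos (Real.log_pos (by norm_num)) (inv_pos.2 (by linarith [𝓜.γ_lt_one]))

lemma Atot_pos : 0 < 𝓜.Atot :=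
  Finset.sum_pos (fun s _ => 𝓜.numActions_pos s) Finset.univ_nonempty

lemma sampleCount_pos {δ : ℝ} (h0 : 0 < δ) (h1 : δ < 1) : 0 < 𝓜.sampleCount δ := by
  rw [sampleCount, Nat.ceil_pos]
  have hA : (1 : ℝ) ≤ 𝓜.Atot := by exact_mod_cast 𝓜.Atot_pos
  have hL : (0 : ℝ) < 𝓜.iterCount := by exact_mod_cast 𝓜.iterCount_pos
  refine mul_pos (by positivity) (Real.log_pos ?_)
  rw [lt_div_iff₀ h0]; linarith

section Iterates

variable (am : 𝓜.SelectionRule) (v₀ : 𝓜.State → ℝ) (π₀ : 𝓜.Policy) (x : 𝓜.Pair → ℝ) (α : ℝ)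
  (M : ℕ) (ω : 𝓜.Tape)

/-- The value vectors grow by a truncated amount. -/
lemma iterates_v_succ_mem (hα : 0 ≤ α) (ℓ : ℕ) (s : 𝓜.State) :
    (𝓜.iterates am v₀ π₀ x α M ω ℓ).v s ≤ (𝓜.iterates am v₀ π₀ x α M ω (ℓ + 1)).v s ∧
    (𝓜.iterates am v₀ π₀ x α M ω (ℓ + 1)).v s ≤
      (𝓜.iterates am v₀ π₀ x α M ω ℓ).v s + (1 - 𝓜.γ) * α := by
  have h0 : 0 ≤ (1 - 𝓜.γ) * α := mul_nonneg (by linarith [𝓜.γ_lt_one]) hα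
  simp only [iterates, iteration]
  split_ifs with h
  · exact ⟨h, min_le_right _ _⟩
  · exact ⟨le_rfl, by linarith⟩

/-- The sampled estimates are accurate up to the shift that the algorithm applies. -/
def IsAccurate (L : ℕ) : Prop :=
  ∀ ℓ < L, ∀ p, |(𝓜.iterates am v₀ π₀ x α M ω ℓ).g p -
    𝓜.utility ((𝓜.iterates am v₀ π₀ x α M ω ℓ).v - v₀) p| ≤ (1 - 𝓜.γ) * α / 8

variable {am v₀ π₀ x α M ω}

/-- Shifting down by exactly the half-width of the error interval trades a two-sided error for a
one-sided error of twice the size. -/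
lemma IsAccurate.gHat_mem {𝓜 : DMDP} {am : 𝓜.SelectionRule} {v₀ : 𝓜.State → ℝ} {π₀ : 𝓜.Policy}
    {x : 𝓜.Pair → ℝ} {α : ℝ} {M : ℕ} {ω : 𝓜.Tape} {L : ℕ}
    (h : 𝓜.IsAccurate am v₀ π₀ x α M ω L) (hα : 0 ≤ α) {ℓ : ℕ} (hℓ : ℓ < L) (p : 𝓜.Pair) :
    𝓜.utility ((𝓜.iterates am v₀ π₀ x α M ω ℓ).v - v₀) p - (1 - 𝓜.γ) * α / 4 ≤
        (𝓜.iterates am v₀ π₀ x α M ω ℓ).gHat p ∧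
      (𝓜.iterates am v₀ π₀ x α M ω ℓ).gHat p ≤
        𝓜.utility ((𝓜.iterates am v₀ π₀ x α M ω ℓ).v - v₀) p := by
  have h0 : 0 ≤ (1 - 𝓜.γ) * α := mul_nonneg (by linarith [𝓜.γ_lt_one]) hα
  have h1 := abs_le.1 (h ℓ hℓ p)
  cases ℓ with
  -- Initially the estimate is not shifted, but it is exact, since both sides are zero.
  | zero =>
    simp only [iterates, sub_self, Pi.zero_apply]
    have : 𝓜.utility 0 p = 0 := 𝓜.utility_const 0 p
    rw [this]
    exact ⟨by linarith, le_rfl⟩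
  | succ ℓ =>
    have h2 : (𝓜.iterates am v₀ π₀ x α M ω (ℓ + 1)).gHat p =
      (𝓜.iterates am v₀ π₀ x α M ω (ℓ + 1)).g p - (1 - 𝓜.γ) * α / 8 := rfl
    rw [h2]
    constructor <;> linarith [h1.1, h1.2]

variable (ham : 𝓜.IsArgmaxRule am) (hα : 0 ≤ α) {β : 𝓜.Pair → ℝ}
  (hx : ∀ p, 𝓜.utility v₀ p - β p ≤ x p ∧ x p ≤ 𝓜.utility v₀ p)

/-- The action values that are used in iteration `ℓ`. -/
def actionValue (x : 𝓜.Pair → ℝ) (I : 𝓜.Iterate) (p : 𝓜.Pair) : ℝ :=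
  𝓜.reward p.1 p.2 + 𝓜.γ * (x p + I.gHat p)

include hα hx in
-- By linearity of `P`, adding the offset `x`, which lies at most `β` below `P v₀`, to the one-sided
-- estimate of `P (v - v₀)` gives a one-sided estimate of `P v`. Discounting its error produces `ξ`.
lemma actionValue_mem {L : ℕ} (h : 𝓜.IsAccurate am v₀ π₀ x α M ω L) {ℓ : ℕ} (hℓ : ℓ < L)
    (p : 𝓜.Pair) :
    𝓜.reward p.1 p.2 + 𝓜.γ * 𝓜.utility (𝓜.iterates am v₀ π₀ x α M ω ℓ).v p -
        𝓜.γ * ((1 - 𝓜.γ) / 4 * α + β p) ≤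
        𝓜.actionValue x (𝓜.iterates am v₀ π₀ x α M ω ℓ) p ∧
      𝓜.actionValue x (𝓜.iterates am v₀ π₀ x α M ω ℓ) p ≤
        𝓜.reward p.1 p.2 + 𝓜.γ * 𝓜.utility (𝓜.iterates am v₀ π₀ x α M ω ℓ).v p := by
  obtain ⟨h1, h2⟩ := h.gHat_mem hα hℓ p
  obtain ⟨h3, h4⟩ := hx p
  rw [utility_sub] at h1 h2
  simp only [actionValue]
  constructor
  · have := mul_le_mul_of_nonneg_left (show 𝓜.utility (𝓜.iterates am v₀ π₀ x α M ω ℓ).v p -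
      ((1 - 𝓜.γ) / 4 * α + β p) ≤ x p + (𝓜.iterates am v₀ π₀ x α M ω ℓ).gHat p by linarith)
      𝓜.γ_nonneg
    linarith
  · have := mul_le_mul_of_nonneg_left (show x p + (𝓜.iterates am v₀ π₀ x α M ω ℓ).gHat p ≤
      𝓜.utility (𝓜.iterates am v₀ π₀ x α M ω ℓ).v p by linarith) 𝓜.γ_nonneg
    linarith

include ham hα hx in
-- At an updated state the new value is at most the backup of the old vector under the new action;
-- at the others the old inequality persists. In both cases the right side can only grow when the
-- old vector is replaced by the larger new one.
lemma iterates_v_le_policyOp (hv : ∀ s, v₀ s ≤ 𝓜.policyOp π₀ v₀ s) {L : ℕ}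
    (h : 𝓜.IsAccurate am v₀ π₀ x α M ω L) {ℓ : ℕ} (hℓ : ℓ ≤ L) (s : 𝓜.State) :
    (𝓜.iterates am v₀ π₀ x α M ω ℓ).v s ≤
      𝓜.policyOp (𝓜.iterates am v₀ π₀ x α M ω ℓ).π (𝓜.iterates am v₀ π₀ x α M ω ℓ).v s := by
  induction ℓ generalizing s with
  | zero => exact hv s
  | succ ℓ ih =>
    have hmono := fun s => (𝓜.iterates_v_succ_mem am v₀ π₀ x α M ω hα ℓ s).1
    set I := 𝓜.iterates am v₀ π₀ x α M ω ℓ with hI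
    set J := 𝓜.iterates am v₀ π₀ x α M ω (ℓ + 1) with hJ
    have hJv : J.v s = if min (⨆ a, 𝓜.actionValue x I ⟨s, a⟩) (I.v s + (1 - 𝓜.γ) * α) ≥ I.v s then
      min (⨆ a, 𝓜.actionValue x I ⟨s, a⟩) (I.v s + (1 - 𝓜.γ) * α) else I.v s := rfl
    have hJπ : J.π s = if min (⨆ a, 𝓜.actionValue x I ⟨s, a⟩) (I.v s + (1 - 𝓜.γ) * α) ≥ I.v s then
      am s fun a => 𝓜.actionValue x I ⟨s, a⟩ else I.π s := rfl
    have hpair : ∀ a, 𝓜.utility I.v ⟨s, a⟩ ≤ 𝓜.utility J.v ⟨s, a⟩ :=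
      fun a => 𝓜.utility_mono hmono _
    simp only [policyOp]
    rw [hJπ, hJv]
    split_ifs with hc
    · refine (min_le_left _ _).trans (ciSup_le fun a => ?_)
      refine (ham s (fun a => 𝓜.actionValue x I ⟨s, a⟩) a).trans ?_
      refine (𝓜.actionValue_mem hα hx h hℓ _).2.trans ?_
      have := mul_le_mul_of_nonneg_left
        (hpair (am s fun a => 𝓜.actionValue x I ⟨s, a⟩)) 𝓜.γ_nonneg
      simp only [← hI]
      linarith
    · have h1 := ih (by omega) s
      have := mul_le_mul_of_nonneg_left (hpair (I.π s)) 𝓜.γ_nonneg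
      simp only [policyOp] at h1
      linarith

include ham hα hx in
lemma iterates_v_le_optimalValue (hv : ∀ s, v₀ s ≤ 𝓜.policyOp π₀ v₀ s) {L : ℕ}
    (h : 𝓜.IsAccurate am v₀ π₀ x α M ω L) {ℓ : ℕ} (hℓ : ℓ ≤ L) (s : 𝓜.State) :
    (𝓜.iterates am v₀ π₀ x α M ω ℓ).v s ≤ 𝓜.optimalValue s :=
  (𝓜.le_policyValue (𝓜.iterates_v_le_policyOp ham hα hx hv h hℓ) s).trans
    (𝓜.policyValue_le_optimalValue _ s)

include hα hx in
lemma optimalValue_sub_iterates_le (hβ : ∀ p, 0 ≤ β p)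
    (hv : ∀ s, 𝓜.optimalValue s - α ≤ v₀ s) {L : ℕ} (h : 𝓜.IsAccurate am v₀ π₀ x α M ω L)
    {πs : 𝓜.Policy} (hπ : 𝓜.IsOptimalPolicy πs) {ℓ : ℕ} (hℓ : ℓ ≤ L) (s : 𝓜.State) :
    𝓜.optimalValue s - (𝓜.iterates am v₀ π₀ x α M ω ℓ).v s ≤
      𝓜.γ ^ ℓ * α + ((1 - 𝓜.γ • 𝓜.policyMatrix πs)⁻¹.mulVec
        fun s => 𝓜.γ * ((1 - 𝓜.γ) / 4 * α + β ⟨s, πs s⟩)) s := by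
  set ξ : 𝓜.State → ℝ := fun s => 𝓜.γ * ((1 - 𝓜.γ) / 4 * α + β ⟨s, πs s⟩) with hξ
  have hγ := 𝓜.γ_lt_one
  have hγ0 := 𝓜.γ_nonneg
  have hξ0 : ∀ s, 0 ≤ ξ s := fun s => by
    have := mul_nonneg (sub_nonneg.2 hγ.le) hα
    have := hβ ⟨s, πs s⟩
    exact mul_nonneg hγ0 (by nlinarith)
  set w := (1 - 𝓜.γ • 𝓜.policyMatrix πs)⁻¹.mulVec ξ with hw
  induction ℓ generalizing s with
  | zero =>
    have := 𝓜.resolvent_nonneg πs hξ0 s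
    simp only [iterates, pow_zero, one_mul]
    linarith [hv s]
  | succ ℓ ih =>
    set I := 𝓜.iterates am v₀ π₀ x α M ω ℓ with hI
    set J := 𝓜.iterates am v₀ π₀ x α M ω (ℓ + 1) with hJ
    have hJv : min (⨆ a, 𝓜.actionValue x I ⟨s, a⟩) (I.v s + (1 - 𝓜.γ) * α) ≤ J.v s := by
      have : J.v s = if min (⨆ a, 𝓜.actionValue x I ⟨s, a⟩) (I.v s + (1 - 𝓜.γ) * α) ≥ I.v s then
        min (⨆ a, 𝓜.actionValue x I ⟨s, a⟩) (I.v s + (1 - 𝓜.γ) * α) else I.v s := rfl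
      rw [this]
      split_ifs with hc
      · exact le_rfl
      · exact (not_le.1 hc).le
    have ih' := ih (by omega)
    -- When the action value is the smaller term, the action of the optimal policy already gives the
    -- contraction: the discount multiplies `γ ^ ℓ α`, and the equation `w = ξ + γ P* w` absorbs the
    -- new error.
    rcases min_le_iff.1 hJv with h1 | h1
    · have h2 : 𝓜.actionValue x I ⟨s, πs s⟩ ≤ ⨆ a, 𝓜.actionValue x I ⟨s, a⟩ :=
        le_ciSup (f := fun a => 𝓜.actionValue x I ⟨s, a⟩) (Set.finite_range _).bddAbove (πs s)
      have h3 := (𝓜.actionValue_mem hα hx h hℓ ⟨s, πs s⟩).1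
      rw [← hI] at h3
      have h4 := hπ.policyOp_eq s
      have h5 := 𝓜.utility_mono (u := 𝓜.optimalValue - I.v) (w := (fun _ => 𝓜.γ ^ ℓ * α) + w)
        (fun s => by simpa using ih' s) ⟨s, πs s⟩
      rw [utility_add, utility_const, utility_sub] at h5
      have h6 := mul_le_mul_of_nonneg_left h5 hγ0
      have h7 := 𝓜.resolvent_eq πs ξ s
      rw [← hw] at h7
      simp only [policyOp] at h4
      have h8 : ξ s = 𝓜.γ * ((1 - 𝓜.γ) / 4 * α + β ⟨s, πs s⟩) := rfl
      rw [pow_succ]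
      simp only at h3
      linarith
    -- When truncation is active the gap shrinks by `(1 - γ) α`, which is at least the required
    -- decrease `(γ ^ ℓ - γ ^ (ℓ + 1)) α`.
    · have h2 := ih' s
      have h3 : 𝓜.γ ^ ℓ ≤ 1 := pow_le_one₀ hγ0 hγ.le
      have h4 : 𝓜.γ ^ ℓ * ((1 - 𝓜.γ) * α) ≤ (1 - 𝓜.γ) * α :=
        mul_le_of_le_one_left (mul_nonneg (by linarith) hα) h3
      rw [pow_succ]
      linarith

end Iterates

end DMDP

/-! Concentration -/

/-- If `Y` is independent of `F` and the conditional means of `ψ F Y` given `F` are at most one,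
then the factor `ψ F Y` does not increase means. -/
lemma integral_mul_le_of_indepFun {Ω A B : Type*} [MeasurableSpace Ω] {μ : Measure Ω}
    [IsProbabilityMeasure μ] [Fintype A] [MeasurableSpace A] [MeasurableSingletonClass A]
    [Finite B] [MeasurableSpace B] [MeasurableSingletonClass B] {F : Ω → A} {Y : Ω → B}
    (hF : Measurable F) (hY : Measurable Y) (h : IndepFun F Y μ) (φ : A → ℝ) (hφ : ∀ a, 0 ≤ φ a)
    (ψ : A → B → ℝ) (hψ : ∀ a, ∫ ω, ψ a (Y ω) ∂μ ≤ 1) :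
    ∫ ω, φ (F ω) * ψ (F ω) (Y ω) ∂μ ≤ ∫ ω, φ (F ω) ∂μ := by
  classical
  -- Conditioning by hand: split according to the finitely many values of `F` by indicators, and
  -- factor each term by independence.
  let e : A → A → ℝ := fun a b => if b = a then 1 else 0
  have he : ∀ a, Integrable (fun ω => e a (F ω)) μ := fun a => by
    exact (Integrable.of_finite (f := e a) (μ := μ.map F)).comp_measurable hF
  have hψi : ∀ a, Integrable (fun ω => ψ a (Y ω)) μ := fun a => by
    exact (Integrable.of_finite (f := ψ a) (μ := μ.map Y)).comp_measurable hY
  have hind : ∀ a, IndepFun (fun ω => e a (F ω)) (fun ω => ψ a (Y ω)) μ := fun a =>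
    h.comp (φ := e a) (ψ := ψ a) (measurable_of_finite _) (measurable_of_finite _)
  have h1 : ∀ ω, φ (F ω) * ψ (F ω) (Y ω) = ∑ a, φ a * (e a (F ω) * ψ a (Y ω)) := fun ω => by
    rw [Finset.sum_eq_single (F ω)] <;> simp +contextual [e, eq_comm]
  have h2 : ∀ ω, φ (F ω) = ∑ a, φ a * e a (F ω) := fun ω => by
    rw [Finset.sum_eq_single (F ω)] <;> simp +contextual [e, eq_comm]
  simp_rw [h1]
  conv_rhs => simp only [h2]
  have h3 : ∀ a, Integrable (fun ω => e a (F ω) * ψ a (Y ω)) μ := fun a =>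
    (hind a).integrable_mul (he a) (hψi a)
  rw [integral_finsetSum _ fun a _ => (h3 a).const_mul _,
    integral_finsetSum _ fun a _ => (he a).const_mul _]
  refine Finset.sum_le_sum fun a _ => ?_
  rw [integral_const_mul, integral_const_mul]
  refine mul_le_mul_of_nonneg_left ?_ (hφ a)
  rw [(hind a).integral_fun_mul_eq_mul_integral (he a).aestronglyMeasurable
    (hψi a).aestronglyMeasurable]
  refine mul_le_of_le_one_right (integral_nonneg fun ω => ?_) (hψ a)
  simp only [e]; split_ifs <;> simp

namespace DMDP

variable {𝓜 : DMDP} {Ω : Type*} [MeasurableSpace Ω] {μ : Measure Ω} [IsProbabilityMeasure μ]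
  {X : 𝓜.Pair → ℕ → Ω → 𝓜.State}

lemma IsGenerativeModel.integral_eq_utility (hX : 𝓜.IsGenerativeModel μ X) (u : 𝓜.State → ℝ)
    (p : 𝓜.Pair) (j : ℕ) : ∫ ω, u (X p j ω) ∂μ = 𝓜.utility u p := by
  have hm := hX.measurable p j
  rw [← integral_map (f := u) hm.aemeasurable
    (measurable_of_finite u).aestronglyMeasurable, integral_fintype Integrable.of_finite, utility]
  refine Finset.sum_congr rfl fun t _ => ?_
  rw [map_measureReal_apply hm (measurableSet_singleton t), smul_eq_mul, ← hX.law p j t]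
  rfl

/-- Hoeffding's bound on the moment generating function of a centered sample mean. -/
lemma IsGenerativeModel.integral_exp_le_one (hX : 𝓜.IsGenerativeModel μ X) {u : 𝓜.State → ℝ}
    {c : ℝ} (hu : ∀ s, u s ∈ Set.Icc 0 c) (p : 𝓜.Pair) (k : ℕ) {M : ℕ} (hM : 0 < M) (t : ℝ) :
    ∫ ω, Real.exp (t * ((1 / (M : ℝ)) * ∑ j ∈ Finset.range M, u (X p (k + j) ω) -
      𝓜.utility u p) - t ^ 2 * c ^ 2 / (8 * M)) ∂μ ≤ 1 := by
  have hM' : (M : ℝ) ≠ 0 := by positivity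
  have hsub : ∀ j, HasSubgaussianMGF (fun ω => u (X p (k + j) ω) - 𝓜.utility u p)
      ((‖c - 0‖₊ / 2) ^ 2) μ := fun j => by
    rw [← hX.integral_eq_utility u p (k + j)]
    exact hasSubgaussianMGF_of_mem_Icc
      ((measurable_of_finite u).comp (hX.measurable p (k + j))).aemeasurable
      (ae_of_all _ fun ω => hu _)
  have hind : iIndepFun (fun j ω => u (X p (k + j) ω) - 𝓜.utility u p) μ := by
    have h1 : iIndepFun (fun j => X p (k + j)) μ :=
      hX.indep.precomp (g := fun j => (p, k + j)) fun a b h => by simpa using h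
    exact h1.comp (fun _ s => u s - 𝓜.utility u p) fun _ => measurable_of_finite _
  -- Each centered term has variance proxy `(c / 2) ^ 2`. Evaluating the sum of `M` terms at `t / M`
  -- gives the exponent `t ^ 2 c ^ 2 / (8 M)`.
  have h2 := (HasSubgaussianMGF.sum_of_iIndepFun hind
    (s := Finset.range M) fun j _ => hsub j).mgf_le (t / M)
  rw [mgf] at h2
  have h3 : ∀ ω, Real.exp (t * ((1 / (M : ℝ)) * ∑ j ∈ Finset.range M, u (X p (k + j) ω) -
      𝓜.utility u p) - t ^ 2 * c ^ 2 / (8 * M)) =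
      Real.exp (-(t ^ 2 * c ^ 2 / (8 * M))) *
        Real.exp (t / M * ∑ j ∈ Finset.range M, (u (X p (k + j) ω) - 𝓜.utility u p)) := fun ω => by
    rw [← Real.exp_add, Finset.sum_sub_distrib]
    congr 1
    simp only [Finset.sum_const, Finset.card_range, nsmul_eq_mul]
    field_simp
    ring
  simp_rw [h3]
  rw [integral_const_mul]
  refine (mul_le_mul_of_nonneg_left h2 (Real.exp_pos _).le).trans (le_of_eq ?_)
  rw [← Real.exp_add, Real.exp_eq_one_iff]
  simp only [Finset.sum_const, Finset.card_range, nsmul_eq_mul, NNReal.coe_mul, NNReal.coe_pow,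
    NNReal.coe_div, coe_nnnorm, NNReal.coe_natCast, NNReal.coe_ofNat, sub_zero, Real.norm_eq_abs,
    div_pow, sq_abs]
  field_simp
  ring

/-! The estimation error -/

section Error

variable (am : 𝓜.SelectionRule) (v₀ : 𝓜.State → ℝ) (π₀ : 𝓜.Policy) (x : 𝓜.Pair → ℝ) (α : ℝ)
  (M : ℕ)

/-- The first `ℓ` iterations depend only on the first `ℓ M` answers for every pair. -/
lemma iterates_congr {ω ω' : 𝓜.Tape} {ℓ : ℕ} (h : ∀ p, ∀ j < ℓ * M, ω p j = ω' p j) :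
    𝓜.iterates am v₀ π₀ x α M ω ℓ = 𝓜.iterates am v₀ π₀ x α M ω' ℓ := by
  induction ℓ with
  | zero => rfl
  | succ ℓ ih =>
    have h1 := ih fun p j hj => h p j (hj.trans_le (Nat.mul_le_mul_right M (Nat.le_succ ℓ)))
    have h2 : ∀ u p, 𝓜.apxUtility u M 0 (fun p j => ω p (ℓ * M + j)) p =
        𝓜.apxUtility u M 0 (fun p j => ω' p (ℓ * M + j)) p := fun u p => by
      simp only [apxUtility, sample_zero]
      congr 1
      refine Finset.sum_congr rfl fun j hj => ?_
      rw [h p _ (by have := Finset.mem_range.1 hj; rw [Nat.succ_mul]; omega)]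
    simp only [iterates, iteration, h1]
    simp only [funext (h2 _)]

/-- The increment of the value vector in iteration `ℓ`. -/
def increment (ω : 𝓜.Tape) (ℓ : ℕ) : 𝓜.State → ℝ :=
  (𝓜.iterates am v₀ π₀ x α M ω (ℓ + 1)).v - (𝓜.iterates am v₀ π₀ x α M ω ℓ).v

/-- The value vector computed in an iteration does not depend on the answers received in it. -/
lemma increment_congr {ω ω' : 𝓜.Tape} {ℓ : ℕ} (h : ∀ p, ∀ j < ℓ * M, ω p j = ω' p j) :
    increment am v₀ π₀ x α M ω ℓ = increment am v₀ π₀ x α M ω' ℓ := by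
  have h1 := iterates_congr am v₀ π₀ x α M h
  simp only [increment, iterates, iteration, h1]

/-- The error of the estimate of the expected increment in iteration `ℓ`. -/
def stepError (ω : 𝓜.Tape) (p : 𝓜.Pair) (ℓ : ℕ) : ℝ :=
  (1 / (M : ℝ)) * ∑ j ∈ Finset.range M, increment am v₀ π₀ x α M ω ℓ (ω p (ℓ * M + j)) -
    𝓜.utility (increment am v₀ π₀ x α M ω ℓ) p

/-- Both `g` and `P (v - v₀)` accumulate one term per increment of `v`, so their difference is a
partial sum of the step errors and accuracy becomes a statement about those sums. -/
lemma sum_stepError (ω : 𝓜.Tape) (p : 𝓜.Pair) (ℓ : ℕ) :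
    ∑ k ∈ Finset.range ℓ, stepError am v₀ π₀ x α M ω p k =
      (𝓜.iterates am v₀ π₀ x α M ω ℓ).g p -
        𝓜.utility ((𝓜.iterates am v₀ π₀ x α M ω ℓ).v - v₀) p := by
  induction ℓ with
  | zero => simp [iterates, utility]
  | succ ℓ ih =>
    have h1 : (𝓜.iterates am v₀ π₀ x α M ω (ℓ + 1)).g p = (𝓜.iterates am v₀ π₀ x α M ω ℓ).g p +
        𝓜.apxUtility (increment am v₀ π₀ x α M ω ℓ) M 0 (fun p j => ω p (ℓ * M + j)) p := rfl
    rw [Finset.sum_range_succ, ih, h1, stepError, apxUtility, sample_zero, increment]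
    simp only [utility_sub]
    ring

/-- The exponential supermartingale of the errors, stopped when it exceeds `K`. -/
def stoppedExp (t κ K : ℝ) (ω : 𝓜.Tape) (p : 𝓜.Pair) : ℕ → ℝ
  | 0 => 1
  | ℓ + 1 => stoppedExp t κ K ω p ℓ * if K ≤ stoppedExp t κ K ω p ℓ then 1 else
      Real.exp (t * stepError am v₀ π₀ x α M ω p ℓ - κ)

lemma stoppedExp_pos (t κ K : ℝ) (ω : 𝓜.Tape) (p : 𝓜.Pair) (ℓ : ℕ) :
    0 < stoppedExp am v₀ π₀ x α M t κ K ω p ℓ := by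
  induction ℓ with
  | zero => exact one_pos
  | succ ℓ ih =>
    rw [stoppedExp]
    refine mul_pos ih ?_
    split_ifs
    · exact one_pos
    · exact Real.exp_pos _

/-- Adaptedness: needed to separate the past from the fresh answers and to have integrability. -/
lemma stoppedExp_congr (t κ K : ℝ) {ω ω' : 𝓜.Tape} (p : 𝓜.Pair) {ℓ : ℕ}
    (h : ∀ p, ∀ j < ℓ * M, ω p j = ω' p j) :
    stoppedExp am v₀ π₀ x α M t κ K ω p ℓ = stoppedExp am v₀ π₀ x α M t κ K ω' p ℓ := by
  induction ℓ with
  | zero => rfl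
  | succ ℓ ih =>
    have h0 : ∀ p, ∀ j < ℓ * M, ω p j = ω' p j := fun p j hj =>
      h p j (hj.trans_le (Nat.mul_le_mul_right M (Nat.le_succ ℓ)))
    have h1 : stepError am v₀ π₀ x α M ω p ℓ = stepError am v₀ π₀ x α M ω' p ℓ := by
      simp only [stepError, increment_congr am v₀ π₀ x α M h0]
      congr 2
      refine Finset.sum_congr rfl fun j hj => ?_
      rw [h p _ (by have := Finset.mem_range.1 hj; rw [Nat.succ_mul]; omega)]
    rw [stoppedExp, stoppedExp, ih h0, h1]

/-- Once the unstopped process has reached `K`, the stopped process is at least `K` forever. -/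
lemma le_stoppedExp (t κ K : ℝ) (ω : 𝓜.Tape) (p : 𝓜.Pair) {ℓ n : ℕ} (hℓ : ℓ ≤ n)
    (h : K ≤ Real.exp (t * ∑ k ∈ Finset.range ℓ, stepError am v₀ π₀ x α M ω p k - ℓ * κ)) :
    K ≤ stoppedExp am v₀ π₀ x α M t κ K ω p n := by
  have stay : ∀ {m}, K ≤ stoppedExp am v₀ π₀ x α M t κ K ω p m →
      K ≤ stoppedExp am v₀ π₀ x α M t κ K ω p (m + 1) := fun {m} hm => by
    rw [stoppedExp, if_pos hm, mul_one]; exact hm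
  -- Either the stopped process has reached `K`, or nothing has been frozen yet and it still equals
  -- the plain exponential.
  have main : ∀ m, K ≤ stoppedExp am v₀ π₀ x α M t κ K ω p m ∨
      stoppedExp am v₀ π₀ x α M t κ K ω p m =
        Real.exp (t * ∑ k ∈ Finset.range m, stepError am v₀ π₀ x α M ω p k - m * κ) := fun m => by
    induction m with
    | zero => right; simp [stoppedExp]
    | succ m ih =>
      rcases ih with ih | ih
      · exact Or.inl (stay ih)
      · by_cases hm : K ≤ stoppedExp am v₀ π₀ x α M t κ K ω p m
        · exact Or.inl (stay hm)
        · right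
          rw [stoppedExp, if_neg hm, ih, ← Real.exp_add, Finset.sum_range_succ]
          congr 1
          push_cast
          ring
  induction n, hℓ using Nat.le_induction with
  | base => rcases main ℓ with h1 | h1
            · exact h1
            · rw [h1]; exact h
  | succ n _ ih => exact stay ih

variable (X) in
/-- The tape of answers. -/
def tape (ω : Ω) : 𝓜.Tape := fun p j => X p j ω

/-- Such a function depends on finitely many answers in a finite set, so it factors through a
measurable map to a finite space. -/
lemma IsGenerativeModel.integrable_comp_tape (hX : 𝓜.IsGenerativeModel μ X)
    {f : 𝓜.Tape → ℝ} {n : ℕ} (hf : ∀ ω ω' : 𝓜.Tape, (∀ p, ∀ j < n, ω p j = ω' p j) → f ω = f ω') :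
    Integrable (fun ω => f (tape X ω)) μ := by
  let F : Ω → 𝓜.Pair → Fin n → 𝓜.State := fun ω p j => X p j ω
  have hF : Measurable F := measurable_pi_lambda _ fun p => measurable_pi_lambda _ fun j =>
    hX.measurable p j
  let e : (𝓜.Pair → Fin n → 𝓜.State) → 𝓜.Tape := fun a p j =>
    if h : j < n then a p ⟨j, h⟩ else Classical.arbitrary _
  have : (fun ω => f (tape X ω)) = fun ω => f (e (F ω)) := by
    funext ω
    refine hf _ _ fun p j hj => ?_
    simp [e, F, hj, tape]
  rw [this]
  exact (Integrable.of_finite (f := fun a => f (e a)) (μ := μ.map F)).comp_measurable hF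

/-- The process at time `ℓ` and the increment of iteration `ℓ` are functions of earlier answers,
while the new factor also uses fresh ones. Given the past the increment is a fixed vector in `[0, (1
- γ) α]`, and Hoeffding's bound makes the mean of the factor at most one. -/
lemma IsGenerativeModel.integral_stoppedExp_le_one (hX : 𝓜.IsGenerativeModel μ X) (hα : 0 ≤ α)
    (hM : 0 < M) (t K : ℝ) (p : 𝓜.Pair) (ℓ : ℕ) :
    ∫ ω, stoppedExp am v₀ π₀ x α M t (t ^ 2 * ((1 - 𝓜.γ) * α) ^ 2 / (8 * M)) K (tape X ω) p ℓ ∂μ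
      ≤ 1 := by
  classical
  set κ := t ^ 2 * ((1 - 𝓜.γ) * α) ^ 2 / (8 * M) with hκ
  induction ℓ with
  | zero => simp [stoppedExp]
  | succ ℓ ih =>
    refine le_trans ?_ ih
    -- `S` indexes the past answers of all pairs, `T` the fresh answers of `p` alone; disjoint
    -- blocks are independent.
    let S : Finset (𝓜.Pair × ℕ) := Finset.univ ×ˢ Finset.range (ℓ * M)
    let T : Finset (𝓜.Pair × ℕ) := {p} ×ˢ Finset.Ico (ℓ * M) (ℓ * M + M)
    have hST : Disjoint S T := Finset.disjoint_left.2 fun q hq hq' => by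
      simp only [S, T, Finset.mem_product, Finset.mem_range, Finset.mem_Ico] at hq hq'
      omega
    let F : Ω → S → 𝓜.State := fun ω q => X q.1.1 q.1.2 ω
    let Y : Ω → T → 𝓜.State := fun ω q => X q.1.1 q.1.2 ω
    have hFY : IndepFun F Y μ :=
      hX.indep.indepFun_finset S T hST fun q => hX.measurable q.1 q.2
    have hF : Measurable F := measurable_pi_lambda _ fun q => hX.measurable q.1.1 q.1.2
    have hY : Measurable Y := measurable_pi_lambda _ fun q => hX.measurable q.1.1 q.1.2
    -- The arbitrary answers outside `S` are harmless: the extended tape is only evaluated through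
    -- quantities determined by the past.
    let ext : (S → 𝓜.State) → 𝓜.Tape := fun a p j =>
      if h : (p, j) ∈ S then a ⟨(p, j), h⟩ else Classical.arbitrary _
    have hext : ∀ ω, ∀ p, ∀ j < ℓ * M, tape X ω p j = ext (F ω) p j := fun ω p j hj => by
      have : (p, j) ∈ S := by simp [S, hj]
      simp only [ext, dif_pos this, F, tape]
    have hT : ∀ j ∈ Finset.range M, (p, ℓ * M + j) ∈ T := fun j hj => by
      have := Finset.mem_range.1 hj
      simp [T, this]
    let y : (T → 𝓜.State) → ℕ → 𝓜.State := fun b j =>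
      if h : (p, ℓ * M + j) ∈ T then b ⟨_, h⟩ else Classical.arbitrary _
    have hy : ∀ ω, ∀ j ∈ Finset.range M, y (Y ω) j = X p (ℓ * M + j) ω := fun ω j hj => by
      simp only [y, dif_pos (hT j hj), Y]
    let Z : 𝓜.Tape → ℝ := fun ω => stoppedExp am v₀ π₀ x α M t κ K ω p ℓ
    let φ : (S → 𝓜.State) → ℝ := fun a => Z (ext a)
    let u : (S → 𝓜.State) → 𝓜.State → ℝ := fun a => increment am v₀ π₀ x α M (ext a) ℓ
    let ψ : (S → 𝓜.State) → (T → 𝓜.State) → ℝ := fun a b =>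
      if K ≤ φ a then 1 else Real.exp (t * ((1 / (M : ℝ)) * ∑ j ∈ Finset.range M, u a (y b j) -
        𝓜.utility (u a) p) - κ)
    have hφ : ∀ ω, Z (tape X ω) = φ (F ω) := fun ω =>
      stoppedExp_congr am v₀ π₀ x α M t κ K p (hext ω)
    have key := integral_mul_le_of_indepFun hF hY hFY φ
      (fun a => (stoppedExp_pos am v₀ π₀ x α M t κ K _ p ℓ).le) ψ (fun a => by
        simp only [ψ]
        split_ifs with h
        · simp
        · have h1 := hX.integral_exp_le_one (u := u a) (c := (1 - 𝓜.γ) * α) (fun s => by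
            have := 𝓜.iterates_v_succ_mem am v₀ π₀ x α M (ext a) hα ℓ s
            simp only [u, increment, Pi.sub_apply, Set.mem_Icc]
            constructor <;> linarith [this.1, this.2]) p (ℓ * M) hM t
          refine le_trans (le_of_eq ?_) h1
          congr 1
          funext ω
          rw [Finset.sum_congr rfl fun j hj => by rw [hy ω j hj]])
    refine le_trans (le_of_eq ?_) (key.trans (le_of_eq ?_))
    · congr 1
      funext ω
      rw [stoppedExp, ← hφ ω]
      congr 1
      simp only [ψ, ← hφ ω]
      congr 2
      have hsum : ∑ j ∈ Finset.range M, u (F ω) (y (Y ω) j) =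
          ∑ j ∈ Finset.range M, u (F ω) (tape X ω p (ℓ * M + j)) :=
        Finset.sum_congr rfl fun j hj => by rw [hy ω j hj]; rfl
      rw [hsum]
      simp only [stepError, increment_congr am v₀ π₀ x α M (hext ω), u]
    · congr 1
      funext ω
      rw [← hφ ω]

/-- Markov's inequality at the single time `n`. Because the stopped process stays above `K` once it
is there, this controls all earlier times as well. -/
lemma IsGenerativeModel.measureReal_stoppedExp_le (hX : 𝓜.IsGenerativeModel μ X) (hα : 0 ≤ α)
    (hM : 0 < M) (t : ℝ) {K : ℝ} (hK : 0 < K) (p : 𝓜.Pair) (n : ℕ) :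
    μ.real {ω | K ≤ stoppedExp am v₀ π₀ x α M t (t ^ 2 * ((1 - 𝓜.γ) * α) ^ 2 / (8 * M)) K
      (tape X ω) p n} ≤ 1 / K := by
  rw [le_div_iff₀' hK]
  refine (mul_meas_ge_le_integral_of_nonneg (ae_of_all _ fun ω =>
    (stoppedExp_pos am v₀ π₀ x α M t _ K _ p n).le) ?_ K).trans
    (hX.integral_stoppedExp_le_one am v₀ π₀ x α M hα hM t K p n)
  exact hX.integrable_comp_tape fun ω ω' h =>
    stoppedExp_congr am v₀ π₀ x α M t _ K p (ℓ := n) h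

lemma card_pair : Fintype.card 𝓜.Pair = 𝓜.Atot := by
  simp [Atot, Fintype.card_sigma]

/-- The estimates are accurate with probability at least `1 - δ`. -/
lemma IsGenerativeModel.measureReal_not_isAccurate_le (hX : 𝓜.IsGenerativeModel μ X)
    (hα : 0 ≤ α) {δ : ℝ} (h0 : 0 < δ) (h1 : δ < 1) :
    μ.real {ω | ¬ 𝓜.IsAccurate am v₀ π₀ x α (𝓜.sampleCount δ) (tape X ω) 𝓜.iterCount} ≤ δ := by
  set M := 𝓜.sampleCount δ with hM
  set L := 𝓜.iterCount with hL
  set c := (1 - 𝓜.γ) * α with hc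
  have hM0 : 0 < M := 𝓜.sampleCount_pos h0 h1
  have hM' : (0 : ℝ) < M := by exact_mod_cast hM0
  have hL' : (0 : ℝ) < L := by exact_mod_cast 𝓜.iterCount_pos
  have hA : (1 : ℝ) ≤ 𝓜.Atot := by exact_mod_cast 𝓜.Atot_pos
  have hc0 : 0 ≤ c := mul_nonneg (by linarith [𝓜.γ_lt_one]) hα
  -- If `c = 0`, all increments vanish and the estimates are exact. This case is separate because
  -- the exponent `y` has `c` in its denominator.
  rcases hc0.eq_or_lt with hc1 | hc1
  · have : ∀ ω, 𝓜.IsAccurate am v₀ π₀ x α M (tape X ω) L := fun ω ℓ _ p => by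
      have h2 : ∀ k, increment am v₀ π₀ x α M (tape X ω) k = 0 := fun k => funext fun s => by
        have := 𝓜.iterates_v_succ_mem am v₀ π₀ x α M (tape X ω) hα k s
        rw [← hc, ← hc1] at this
        simp only [increment, Pi.sub_apply, Pi.zero_apply]
        linarith [this.1, this.2]
      rw [← sum_stepError, ← hc, ← hc1]
      simp [stepError, h2, utility]
    simp [this, h0.le]
  -- This `y` maximizes `y c / 8 - L y ^ 2 c ^ 2 / (8 M)`; the maximum is `M / (32 L)`, which is the
  -- logarithm of the level `K`.
  set y : ℝ := M / (2 * L * c) with hy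
  set K : ℝ := Real.exp (M / (32 * L)) with hK
  let B : ℝ → 𝓜.Pair → Set Ω := fun t p => {ω | K ≤ stoppedExp am v₀ π₀ x α M t
    (t ^ 2 * c ^ 2 / (8 * M)) K (tape X ω) p L}
  have hB : ∀ t p, μ.real (B t p) ≤ δ / (2 * 𝓜.Atot) := fun t p => by
    refine (hX.measureReal_stoppedExp_le am v₀ π₀ x α M hα hM0 t (Real.exp_pos _) p L).trans ?_
    -- The factor `2 ^ 8` in the sample count leaves room: `M / (32 L)` is even at least eight times
    -- this logarithm.
    have h2 : Real.log (2 * 𝓜.Atot / δ) ≤ M / (32 * L) := by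
      have h3 := Nat.le_ceil ((𝓜.iterCount : ℝ) * 2 ^ 8 * Real.log (2 * (𝓜.Atot : ℝ) / δ))
      change _ ≤ (M : ℝ) at h3
      have h4 : 0 ≤ Real.log (2 * 𝓜.Atot / δ) :=
        Real.log_nonneg (by rw [le_div_iff₀ h0]; linarith)
      rw [le_div_iff₀ (by positivity)]
      nlinarith [mul_nonneg hL'.le h4]
    have h5 : δ / (2 * 𝓜.Atot) = 1 / (2 * 𝓜.Atot / δ) := by rw [one_div, inv_div]
    rw [h5]
    refine one_div_le_one_div_of_le (by positivity) ?_
    rw [← Real.exp_log (show 0 < 2 * (𝓜.Atot : ℝ) / δ by positivity)]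
    exact Real.exp_le_exp.2 h2
  have hsub : {ω | ¬ 𝓜.IsAccurate am v₀ π₀ x α M (tape X ω) L} ⊆
      ⋃ p ∈ (Finset.univ : Finset 𝓜.Pair), (B y p ∪ B (-y) p) := fun ω hω => by
    simp only [IsAccurate, Set.mem_ofPred_eq, not_forall, not_le] at hω
    obtain ⟨ℓ, hℓ, p, hp⟩ := hω
    rw [← sum_stepError, ← hc, lt_abs] at hp
    have hℓ' : (ℓ : ℝ) ≤ L := by exact_mod_cast hℓ.le
    have key : ∀ S : ℝ, c / 8 < S → K ≤ Real.exp (y * S - ℓ * (y ^ 2 * c ^ 2 / (8 * M))) :=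
      fun S hS => by
        refine Real.exp_le_exp.2 ?_
        have h2 : y * (c / 8) ≤ y * S := mul_le_mul_of_nonneg_left hS.le (by positivity)
        have h3 : ℓ * (y ^ 2 * c ^ 2 / (8 * M)) ≤ L * (y ^ 2 * c ^ 2 / (8 * M)) :=
          mul_le_mul_of_nonneg_right hℓ' (by positivity)
        have h4 : y * (c / 8) = M / (16 * L) := by rw [hy]; field_simp; norm_num
        have h5 : L * (y ^ 2 * c ^ 2 / (8 * M)) = M / (32 * L) := by rw [hy]; field_simp; norm_num
        have h6 : (M : ℝ) / (16 * L) = M / (32 * L) + M / (32 * L) := by field_simp; norm_num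
        linarith
    simp only [Set.mem_iUnion, Finset.mem_univ, exists_true_left, Set.mem_union]
    refine ⟨p, hp.imp (fun h => ?_) fun h => ?_⟩
    · exact le_stoppedExp am v₀ π₀ x α M _ _ K _ p hℓ.le (key _ h)
    · refine le_stoppedExp am v₀ π₀ x α M _ _ K _ p hℓ.le ?_
      rw [neg_sq, neg_mul, ← mul_neg]
      exact key _ h
  calc μ.real {ω | ¬ 𝓜.IsAccurate am v₀ π₀ x α M (tape X ω) L}
      ≤ ∑ p : 𝓜.Pair, μ.real (B y p ∪ B (-y) p) :=
        (measureReal_mono hsub (measure_ne_top _ _)).trans (measureReal_biUnion_finset_le _ _)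
    _ ≤ ∑ p : 𝓜.Pair, (δ / (2 * 𝓜.Atot) + δ / (2 * 𝓜.Atot)) :=
        Finset.sum_le_sum fun p _ => (measureReal_union_le _ _).trans (add_le_add (hB _ _) (hB _ _))
    _ = δ := by
        rw [Finset.sum_const, Finset.card_univ, card_pair, nsmul_eq_mul]
        field_simp
        norm_num

/-- The accuracy of the output. -/
lemma IsGenerativeModel.le_measureReal_output (hX : 𝓜.IsGenerativeModel μ X)
    (ham : 𝓜.IsArgmaxRule am) {β : 𝓜.Pair → ℝ} {δ : ℝ} (h0 : 0 < δ) (h1 : δ < 1)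
    (hβ : ∀ p, 0 ≤ β p) (hx : ∀ p, 𝓜.utility v₀ p - β p ≤ x p ∧ x p ≤ 𝓜.utility v₀ p)
    (hv : IsUnderestimate α v₀ 𝓜.optimalValue) (hπ : ∀ s, v₀ s ≤ 𝓜.policyOp π₀ v₀ s) :
    1 - δ ≤ μ.real {ω |
      let out := 𝓜.truncatedVRVI am v₀ π₀ x α δ (fun p j => X p j ω)
      let v := out.1
      let π := out.2
      (∀ s, 0 ≤ 𝓜.optimalValue s - v s) ∧
      (∀ πs : 𝓜.Policy, 𝓜.IsOptimalPolicy πs →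
        let ξ : 𝓜.State → ℝ := fun s => 𝓜.γ * ((1 - 𝓜.γ) / 4 * α + β ⟨s, πs s⟩)
        ∀ s, 𝓜.optimalValue s - v s ≤
          𝓜.γ ^ 𝓜.iterCount * α + ((1 - 𝓜.γ • 𝓜.policyMatrix πs)⁻¹.mulVec ξ) s) ∧
      (∀ s, v s ≤ 𝓜.policyOp π v s) ∧
      (β = 0 → ∀ s, 𝓜.optimalValue s - v s ≤ α / 2)} := by
  obtain ⟨hα, hv⟩ := hv
  have hbad := hX.measureReal_not_isAccurate_le am v₀ π₀ x α hα h0 h1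
  have huniv : 1 ≤ μ.real {ω | 𝓜.IsAccurate am v₀ π₀ x α (𝓜.sampleCount δ) (tape X ω)
      𝓜.iterCount} + μ.real {ω | ¬ 𝓜.IsAccurate am v₀ π₀ x α (𝓜.sampleCount δ) (tape X ω)
      𝓜.iterCount} := by
    refine le_trans (le_of_eq ?_) (measureReal_union_le _ _)
    rw [← probReal_univ (μ := μ)]
    congr 1
    ext ω
    simp [em]
  refine (by linarith : 1 - δ ≤ _).trans (measureReal_mono fun ω hω => ?_)
  have hω' : 𝓜.IsAccurate am v₀ π₀ x α (𝓜.sampleCount δ) (tape X ω) 𝓜.iterCount := hω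
  have hmain := fun πs (h : 𝓜.IsOptimalPolicy πs) s =>
    𝓜.optimalValue_sub_iterates_le hα hx hβ (fun s => (hv s).1) hω' h le_rfl s
  refine ⟨fun s => sub_nonneg.2 (𝓜.iterates_v_le_optimalValue ham hα hx hπ hω' le_rfl s),
    hmain, 𝓜.iterates_v_le_policyOp ham hα hx hπ hω' le_rfl, fun hβ0 s => ?_⟩
  obtain ⟨πs, hπs⟩ := 𝓜.exists_isOptimalPolicy
  have h2 := hmain πs hπs s
  -- For `β = 0` the resolvent term is at most `α / 4`; together with `γ ^ L α ≤ α / 8` this stays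
  -- below `α / 2`.
  have h3 := 𝓜.resolvent_le_const πs
    (ξ := fun s => 𝓜.γ * ((1 - 𝓜.γ) / 4 * α + β ⟨s, πs s⟩)) (K := α / 4) (fun s => by
      have h4 := mul_nonneg (sub_nonneg.2 𝓜.γ_lt_one.le) hα
      have := mul_le_of_le_one_left h4 𝓜.γ_lt_one.le
      simp only [hβ0, Pi.zero_apply]
      linarith) s
  have h5 := mul_le_mul_of_nonneg_right 𝓜.pow_iterCount_le hα
  exact h2.trans (by linarith)

end Error

end DMDP

namespace RealRAM

/-! Specifications of programs -/

/-- The cells at positions below `n` of the first arrays. -/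
def workspace (n : ℕ) : Finset Cell :=
  (Finset.range 24 ×ˢ Finset.range n).image (fun q => Cell.idx q.1 q.2) ∪
    (Finset.range 24 ×ˢ Finset.range n).image (fun q => Cell.real q.1 q.2)

@[simp] lemma idx_mem_workspace {n a i : ℕ} : Cell.idx a i ∈ workspace n ↔ a < 24 ∧ i < n := by
  simp [workspace]

@[simp] lemma real_mem_workspace {n a i : ℕ} : Cell.real a i ∈ workspace n ↔ a < 24 ∧ i < n := by
  simp [workspace]

lemma card_workspace_le (n : ℕ) : (workspace n).card ≤ 48 * n := by
  refine (Finset.card_union_le _ _).trans ?_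
  refine (add_le_add Finset.card_image_le Finset.card_image_le).trans ?_
  simp only [Finset.card_product, Finset.card_range]
  omega

/-- `σ'` arises from `σ` by changing only the index arrays in `DI` and the real arrays in `DR`,
with at most `q` queries and `k` steps, and accessing only the workspace of size `n`. -/
structure Frame (n : ℕ) (DI DR : Finset ℕ) (q k : ℕ) (σ σ' : Config) : Prop where
  idx : ∀ a ∉ DI, σ'.idx a = σ.idx a
  real : ∀ a ∉ DR, σ'.real a = σ.real a
  asked : q = 0 → σ'.asked = σ.asked
  time : σ'.time ≤ σ.time + k
  queries : σ'.queries ≤ σ.queries + q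
  touched : σ.touched ⊆ workspace n → σ'.touched ⊆ workspace n

lemma Frame.refl (n : ℕ) (DI DR : Finset ℕ) (q k : ℕ) (σ : Config) : Frame n DI DR q k σ σ :=
  ⟨fun _ _ => rfl, fun _ _ => rfl, fun _ => rfl, Nat.le_add_right _ _, Nat.le_add_right _ _, id⟩

lemma Frame.trans {n : ℕ} {DI₁ DR₁ DI₂ DR₂ DI DR : Finset ℕ} {q₁ k₁ q₂ k₂ q k : ℕ}
    {σ σ₁ σ₂ : Config} (h₁ : Frame n DI₁ DR₁ q₁ k₁ σ σ₁) (h₂ : Frame n DI₂ DR₂ q₂ k₂ σ₁ σ₂)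
    (hI : DI₁ ∪ DI₂ ⊆ DI) (hR : DR₁ ∪ DR₂ ⊆ DR) (hq : q₁ + q₂ ≤ q) (hk : k₁ + k₂ ≤ k) :
    Frame n DI DR q k σ σ₂ := by
  refine ⟨fun a ha => ?_, fun a ha => ?_, fun h => ?_, ?_, ?_, fun h => h₂.touched (h₁.touched h)⟩
  · rw [h₂.idx a fun h => ha (hI (Finset.mem_union_right _ h)),
      h₁.idx a fun h => ha (hI (Finset.mem_union_left _ h))]
  · rw [h₂.real a fun h => ha (hR (Finset.mem_union_right _ h)),
      h₁.real a fun h => ha (hR (Finset.mem_union_left _ h))]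
  · rw [h₂.asked (by omega), h₁.asked (by omega)]
  · have := h₁.time; have := h₂.time; omega
  · have := h₁.queries; have := h₂.queries; omega

lemma frame_charge {n : ℕ} {DI DR : Finset ℕ} {σ : Config} {cells : Finset Cell}
    (h : cells ⊆ workspace n) : Frame n DI DR 0 1 σ (σ.charge cells) :=
  ⟨fun _ _ => rfl, fun _ _ => rfl, fun _ => rfl, le_rfl, le_rfl, fun h' =>
    Finset.union_subset h' h⟩

/-- Started in `σ`, the program `p` halts in a configuration that satisfies `Q`, with a bound on
the changes and the costs. -/
def Spec (O : ℕ → ℕ → ℕ → ℕ) (n : ℕ) (p : Prog) (DI DR : Finset ℕ) (q k : ℕ) (σ : Config)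
    (Q : Config → Prop) : Prop :=
  ∃ σ', Exec O p σ σ' ∧ Frame n DI DR q k σ σ' ∧ Q σ'

variable {O : ℕ → ℕ → ℕ → ℕ} {n : ℕ}

lemma Spec.mono {p : Prog} {DI₁ DR₁ DI DR : Finset ℕ} {q₁ k₁ q k : ℕ} {σ : Config}
    {Q₁ Q : Config → Prop} (h : Spec O n p DI₁ DR₁ q₁ k₁ σ Q₁)
    (hQ : ∀ σ', Frame n DI₁ DR₁ q₁ k₁ σ σ' → Q₁ σ' → Q σ')
    (hI : DI₁ ⊆ DI := by decide) (hR : DR₁ ⊆ DR := by decide) (hq : q₁ ≤ q := by omega)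
    (hk : k₁ ≤ k := by omega) : Spec O n p DI DR q k σ Q := by
  obtain ⟨σ', h1, h2, h3⟩ := h
  exact ⟨σ', h1, h2.trans (Frame.refl n ∅ ∅ 0 0 σ') (by simpa) (by simpa) hq hk, hQ σ' h2 h3⟩

lemma Spec.seq {p₁ p₂ : Prog} {DI₁ DR₁ DI₂ DR₂ DI DR : Finset ℕ} {q₁ k₁ q₂ k₂ q k : ℕ}
    {σ : Config} {Q₁ Q : Config → Prop} (h₁ : Spec O n p₁ DI₁ DR₁ q₁ k₁ σ Q₁)
    (h₂ : ∀ σ₁, Frame n DI₁ DR₁ q₁ k₁ σ σ₁ → Q₁ σ₁ → Spec O n p₂ DI₂ DR₂ q₂ k₂ σ₁ Q)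
    (hI : DI₁ ∪ DI₂ ⊆ DI := by decide) (hR : DR₁ ∪ DR₂ ⊆ DR := by decide)
    (hq : q₁ + q₂ ≤ q := by omega) (hk : k₁ + k₂ ≤ k := by omega) :
    Spec O n (.seq p₁ p₂) DI DR q k σ Q := by
  obtain ⟨σ₁, e₁, f₁, r₁⟩ := h₁
  obtain ⟨σ₂, e₂, f₂, r₂⟩ := h₂ σ₁ f₁ r₁
  exact ⟨σ₂, .seq e₁ e₂, f₁.trans f₂ hI hR hq hk, r₂⟩

lemma Spec.cond {b : Test} {p₁ p₂ : Prog} {DI DR : Finset ℕ} {q k : ℕ} {σ : Config}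
    {Q : Config → Prop} (hb : b.cells σ ⊆ workspace n)
    (h₁ : b.holds σ → Spec O n p₁ DI DR q k (σ.charge (b.cells σ)) Q)
    (h₂ : ¬ b.holds σ → Spec O n p₂ DI DR q k (σ.charge (b.cells σ)) Q) :
    Spec O n (.cond b p₁ p₂) DI DR q (k + 1) σ Q := by
  by_cases h : b.holds σ
  · obtain ⟨σ', e, f, r⟩ := h₁ h
    exact ⟨σ', .cond_true h e, (frame_charge (DI := ∅) (DR := ∅) hb).trans f (by simp) (by simp)
      (by omega) (by omega), r⟩
  · obtain ⟨σ', e, f, r⟩ := h₂ h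
    exact ⟨σ', .cond_false h e, (frame_charge (DI := ∅) (DR := ∅) hb).trans f (by simp) (by simp)
      (by omega) (by omega), r⟩

/-- A loop that runs `N` times, with costs depending on the iteration. -/
lemma Spec.loop {b : Test} {p : Prog} {DI DR : Finset ℕ} (q k : ℕ → ℕ) {σ : Config} (N : ℕ)
    (I : ℕ → Config → Prop) (h0 : I 0 σ)
    (hb : ∀ j ≤ N, ∀ σ', Frame n DI DR (∑ i ∈ Finset.range j, q i)
      (∑ i ∈ Finset.range j, (k i + 1)) σ σ' → I j σ' → b.cells σ' ⊆ workspace n)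
    (hlt : ∀ j < N, ∀ σ', Frame n DI DR (∑ i ∈ Finset.range j, q i)
      (∑ i ∈ Finset.range j, (k i + 1)) σ σ' → I j σ' → b.holds σ' ∧
        Spec O n p DI DR (q j) (k j) (σ'.charge (b.cells σ')) (I (j + 1)))
    (hN : ∀ σ', Frame n DI DR (∑ i ∈ Finset.range N, q i)
      (∑ i ∈ Finset.range N, (k i + 1)) σ σ' → I N σ' → ¬ b.holds σ')
    (hI : ∀ σ' cells, I N σ' → I N (σ'.charge cells)) :
    Spec O n (.loop b p) DI DR (∑ i ∈ Finset.range N, q i)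
      (∑ i ∈ Finset.range N, (k i + 1) + 1) σ (I N) := by
  -- The induction is on the remaining iterations `m`, since an execution unrolls the loop from the
  -- front, while the invariant counts the `j` completed ones. Each iteration pays one step for its
  -- test, and the failing test pays the last one.
  have main : ∀ m j, j + m = N → ∀ σ', Frame n DI DR (∑ i ∈ Finset.range j, q i)
      (∑ i ∈ Finset.range j, (k i + 1)) σ σ' → I j σ' →
      ∃ σ'', Exec O (.loop b p) σ' σ'' ∧ Frame n DI DR (∑ i ∈ Finset.range N, q i)
        (∑ i ∈ Finset.range N, (k i + 1) + 1) σ σ'' ∧ I N σ'' := by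
    intro m
    induction m with
    | zero =>
      rintro j rfl σ' hf hi
      exact ⟨_, .loop_false (hN σ' hf hi), hf.trans (frame_charge (DI := ∅) (DR := ∅)
        (hb _ le_rfl σ' hf hi)) (by simp) (by simp) le_rfl le_rfl, hI _ _ hi⟩
    | succ m ih =>
      rintro j hj σ' hf hi
      obtain ⟨h1, σ₁, e₁, f₁, r₁⟩ := hlt j (by omega) σ' hf hi
      obtain ⟨σ₂, e₂, f₂, r₂⟩ := ih (j + 1) (by omega) σ₁ (by
        refine hf.trans ((frame_charge (DI := ∅) (DR := ∅) (hb j (by omega) σ' hf hi)).trans f₁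
          (DI := DI) (DR := DR) (by simp) (by simp) le_rfl le_rfl) (by simp) (by simp) ?_ ?_
        · rw [Finset.sum_range_succ]; omega
        · rw [Finset.sum_range_succ]; omega) r₁
      exact ⟨σ₂, .loop_true h1 e₁ e₂, f₂, r₂⟩
  exact main N 0 (by omega) σ (Frame.refl _ _ _ _ _ _) h0

/-! Blocks of instructions -/

/-- The sequential composition of instructions. -/
def block : Instr → List Instr → Prog
  | c, [] => .instr c
  | c, c' :: l => .seq (.instr c) (block c' l)

/-- The index arrays that an instruction may change. -/
def Instr.iDest : Instr → Finset ℕ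
  | .iConst d _ => {d.arr}
  | .iCopy d _ => {d.arr}
  | .iSucc d => {d.arr}
  | .query d _ _ => {d.arr}
  | _ => ∅

/-- The real arrays that an instruction may change. -/
def Instr.rDest : Instr → Finset ℕ
  | .rConst d _ => {d.arr}
  | .rCopy d _ => {d.arr}
  | .rOp _ d _ _ => {d.arr}
  | .rLog d _ => {d.arr}
  | _ => ∅

/-- The number of queries of an instruction. -/
def Instr.cost : Instr → ℕ
  | .query _ _ _ => 1
  | _ => 0

lemma update₂_apply {β : Type} (f : ℕ → ℕ → β) (a i : ℕ) (y : β) (b j : ℕ) :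
    update₂ f a i y b j = if b = a ∧ j = i then y else f b j := by
  by_cases h : b = a
  · subst h
    by_cases h' : j = i
    · subst h'; simp [update₂]
    · simp [update₂, h']
  · simp [update₂, h]

lemma update₂_of_ne {β : Type} (f : ℕ → ℕ → β) {a b : ℕ} (i : ℕ) (y : β) (h : b ≠ a) :
    update₂ f a i y b = f b := by
  simp [update₂, h]

lemma frame_step (c : Instr) {σ : Config} (h : c.cells σ ⊆ workspace n) :
    Frame n c.iDest c.rDest c.cost 1 σ (c.step O σ) := by
  refine ⟨fun a ha => ?_, fun a ha => ?_, fun hq => ?_, ?_, ?_, fun h' =>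
    Finset.union_subset (by cases c <;> exact h') h⟩
  · cases c <;> first
      | rfl
      | exact update₂_of_ne _ _ _ (by simpa [Instr.iDest] using ha)
  · cases c <;> first
      | rfl
      | exact update₂_of_ne _ _ _ (by simpa [Instr.rDest] using ha)
  · cases c <;> first
      | rfl
      | simp [Instr.cost] at hq
  · cases c <;> exact le_rfl
  · cases c <;> exact le_rfl

/-- The configuration after executing the instructions. -/
def run (O : ℕ → ℕ → ℕ → ℕ) (σ : Config) (l : List Instr) : Config :=
  l.foldl (fun σ c => c.step O σ) σ

@[simp] lemma run_nil (σ : Config) : run O σ [] = σ := rfl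

@[simp] lemma run_cons (σ : Config) (c : Instr) (l : List Instr) :
    run O σ (c :: l) = run O (c.step O σ) l := rfl

/-- All accesses of the instructions are to the workspace. -/
def Inside (O : ℕ → ℕ → ℕ → ℕ) (n : ℕ) : Config → List Instr → Prop
  | _, [] => True
  | σ, c :: l => c.cells σ ⊆ workspace n ∧ Inside O n (c.step O σ) l

/-- Straight-line code is handled by symbolic execution: the postcondition is checked on `run`, and
the changed arrays and costs can be read off the instruction list. -/
lemma Spec.block {c : Instr} {l : List Instr} {DI DR : Finset ℕ} {q k : ℕ} {σ : Config}
    {Q : Config → Prop} (hin : Inside O n σ (c :: l)) (hQ : Q (run O σ (c :: l)))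
    (hI : ∀ c' ∈ c :: l, c'.iDest ⊆ DI := by decide)
    (hR : ∀ c' ∈ c :: l, c'.rDest ⊆ DR := by decide)
    (hq : ((c :: l).map Instr.cost).sum ≤ q := by decide)
    (hk : (c :: l).length ≤ k := by decide) :
    Spec O n (RealRAM.block c l) DI DR q k σ Q := by
  induction l generalizing c σ q k with
  | nil =>
    exact ⟨_, .instr c σ, (frame_step c hin.1).trans (Frame.refl n ∅ ∅ 0 0 _)
      (by simpa using hI) (by simpa using hR) (by simpa using hq) (by simpa using hk), hQ⟩
  | cons c' l ih =>
    have h1 : Spec O n (.instr c) c.iDest c.rDest c.cost 1 σ (fun σ' => σ' = c.step O σ) :=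
      ⟨_, .instr c σ, frame_step c hin.1, rfl⟩
    simp only [List.map_cons, List.sum_cons, List.length_cons] at hq hk
    refine Spec.seq h1 (DI₂ := DI) (DR₂ := DR) (q₂ := q - c.cost) (k₂ := k - 1) ?_
      (Finset.union_subset (hI c (by simp)) (subset_refl _))
      (Finset.union_subset (hR c (by simp)) (subset_refl _)) (by omega) (by omega)
    rintro σ₁ - rfl
    exact ih hin.2 hQ (fun c₂ hc => hI c₂ (List.mem_cons_of_mem _ hc))
      (fun c₂ hc => hR c₂ (List.mem_cons_of_mem _ hc))
      (by simp only [List.map_cons, List.sum_cons]; omega)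
      (by simp only [List.length_cons]; omega)

/-! Effects of instructions -/

section Effects

variable (σ : Config) (d s t : Ref) (c : ℕ) (o : ROp) (a i : ℕ)

@[simp] lemma step_iConst_idx : (Instr.step O σ (.iConst d c)).idx a i =
    if a = d.arr ∧ i = d.pos σ then c else σ.idx a i := update₂_apply _ _ _ _ _ _

@[simp] lemma step_iCopy_idx : (Instr.step O σ (.iCopy d s)).idx a i =
    if a = d.arr ∧ i = d.pos σ then s.iVal σ else σ.idx a i := update₂_apply _ _ _ _ _ _

@[simp] lemma step_iSucc_idx : (Instr.step O σ (.iSucc d)).idx a i =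
    if a = d.arr ∧ i = d.pos σ then d.iVal σ + 1 else σ.idx a i := update₂_apply _ _ _ _ _ _

@[simp] lemma step_query_idx : (Instr.step O σ (.query d s t)).idx a i =
    if a = d.arr ∧ i = d.pos σ then O (s.iVal σ) (t.iVal σ) (σ.asked (s.iVal σ) (t.iVal σ))
    else σ.idx a i := update₂_apply _ _ _ _ _ _

@[simp] lemma step_rConst_idx : (Instr.step O σ (.rConst d c)).idx = σ.idx := rfl

@[simp] lemma step_rCopy_idx : (Instr.step O σ (.rCopy d s)).idx = σ.idx := rfl

@[simp] lemma step_rOp_idx : (Instr.step O σ (.rOp o d s t)).idx = σ.idx := rfl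

@[simp] lemma step_rLog_idx : (Instr.step O σ (.rLog d s)).idx = σ.idx := rfl

@[simp] lemma step_rConst_real : (Instr.step O σ (.rConst d c)).real a i =
    if a = d.arr ∧ i = d.pos σ then (c : ℝ) else σ.real a i := update₂_apply _ _ _ _ _ _

@[simp] lemma step_rCopy_real : (Instr.step O σ (.rCopy d s)).real a i =
    if a = d.arr ∧ i = d.pos σ then s.rVal σ else σ.real a i := update₂_apply _ _ _ _ _ _

@[simp] lemma step_rOp_real : (Instr.step O σ (.rOp o d s t)).real a i =
    if a = d.arr ∧ i = d.pos σ then o.eval (s.rVal σ) (t.rVal σ) else σ.real a i :=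
  update₂_apply _ _ _ _ _ _

@[simp] lemma step_rLog_real : (Instr.step O σ (.rLog d s)).real a i =
    if a = d.arr ∧ i = d.pos σ then Real.log (s.rVal σ) else σ.real a i :=
  update₂_apply _ _ _ _ _ _

@[simp] lemma step_iConst_real : (Instr.step O σ (.iConst d c)).real = σ.real := rfl

@[simp] lemma step_iCopy_real : (Instr.step O σ (.iCopy d s)).real = σ.real := rfl

@[simp] lemma step_iSucc_real : (Instr.step O σ (.iSucc d)).real = σ.real := rfl

@[simp] lemma step_query_real : (Instr.step O σ (.query d s t)).real = σ.real := rfl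

@[simp] lemma step_query_asked : (Instr.step O σ (.query d s t)).asked a i =
    if a = s.iVal σ ∧ i = t.iVal σ then σ.asked (s.iVal σ) (t.iVal σ) + 1 else σ.asked a i :=
  update₂_apply _ _ _ _ _ _

@[simp] lemma step_rOp_asked : (Instr.step O σ (.rOp o d s t)).asked = σ.asked := rfl

@[simp] lemma step_iSucc_asked : (Instr.step O σ (.iSucc d)).asked = σ.asked := rfl

variable (cells : Finset Cell)

@[simp] lemma charge_idx : (σ.charge cells).idx = σ.idx := rfl

@[simp] lemma charge_real : (σ.charge cells).real = σ.real := rfl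

@[simp] lemma charge_asked : (σ.charge cells).asked = σ.asked := rfl

end Effects

section References

variable (σ : Config) (a i : ℕ)

@[simp] lemma pos_scalar : (Ref.scalar a).pos σ = 0 := rfl

@[simp] lemma pos_entry : (Ref.entry a i).pos σ = σ.idx i 0 := rfl

@[simp] lemma arr_scalar : (Ref.scalar a).arr = a := rfl

@[simp] lemma arr_entry : (Ref.entry a i).arr = a := rfl

@[simp] lemma iVal_scalar : (Ref.scalar a).iVal σ = σ.idx a 0 := rfl

@[simp] lemma iVal_entry : (Ref.entry a i).iVal σ = σ.idx a (σ.idx i 0) := rfl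

@[simp] lemma rVal_scalar : (Ref.scalar a).rVal σ = σ.real a 0 := rfl

@[simp] lemma rVal_entry : (Ref.entry a i).rVal σ = σ.real a (σ.idx i 0) := rfl

@[simp] lemma iCells_scalar_subset :
    (Ref.scalar a).iCells σ ⊆ workspace n ↔ a < 24 ∧ 0 < n := by
  simp [Ref.iCells, Ref.aux]

@[simp] lemma iCells_entry_subset : (Ref.entry a i).iCells σ ⊆ workspace n ↔
    (a < 24 ∧ σ.idx i 0 < n) ∧ i < 24 ∧ 0 < n := by
  simp [Ref.iCells, Ref.aux, Finset.insert_subset_iff]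

@[simp] lemma rCells_scalar_subset :
    (Ref.scalar a).rCells σ ⊆ workspace n ↔ a < 24 ∧ 0 < n := by
  simp [Ref.rCells, Ref.aux]

@[simp] lemma rCells_entry_subset : (Ref.entry a i).rCells σ ⊆ workspace n ↔
    (a < 24 ∧ σ.idx i 0 < n) ∧ i < 24 ∧ 0 < n := by
  simp [Ref.rCells, Ref.aux, Finset.insert_subset_iff]

@[simp] lemma iLt_cells_subset (s t : Ref) : (Test.iLt s t).cells σ ⊆ workspace n ↔
    s.iCells σ ⊆ workspace n ∧ t.iCells σ ⊆ workspace n := Finset.union_subset_iff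

@[simp] lemma rLt_cells_subset (s t : Ref) : (Test.rLt s t).cells σ ⊆ workspace n ↔
    s.rCells σ ⊆ workspace n ∧ t.rCells σ ⊆ workspace n := Finset.union_subset_iff

@[simp] lemma iLt_holds (s t : Ref) : (Test.iLt s t).holds σ ↔ s.iVal σ < t.iVal σ := Iff.rfl

@[simp] lemma rLt_holds (s t : Ref) : (Test.rLt s t).holds σ ↔ s.rVal σ < t.rVal σ := Iff.rfl

end References

end RealRAM

namespace RealRAM

/-! The program

Its index arrays are: `0` number of states, `1` numbers of actions, `2` policy, `3` number of
iterations, `4` number of samples, `5` iteration, `6` state, `7` action, `8` position of the pair,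
`9` sample, `10` answer of the model, `11` best action. Its real arrays are: `0`, `1`, `2` the
parameters `γ`, `α`, `δ`, `3` values, `4` rewards, `5` offsets `x`, `6` estimates `g`, `7`
increments, `8` one, `9` counter, `10` target of the counter, `11` the truncation threshold,
`12` current shift of the estimates, `13` shift from the second iteration on, `14` best action
value, `15` action value, `16` sum of samples, `17` number of pairs, `18` number of iterations,
`19` `1 - γ`, `20` new value. -/

/-- Rounds the target up, into the index array `d` and the counter. -/
def ceilLoop (d : ℕ) : Prog :=
  .loop (.rLt (.scalar 9) (.scalar 10))
    (block (.iSucc (.scalar d)) [.rOp .add (.scalar 9) (.scalar 9) (.scalar 8)])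

/-- Loops over the states. -/
def stateLoop (p : Prog) : Prog := .loop (.iLt (.scalar 6) (.scalar 0)) p

/-- Loops over the actions of a state. -/
def actionLoop (p : Prog) : Prog := .loop (.iLt (.scalar 7) (.entry 1 6)) p

/-- Counts the state-action pairs. -/
def countPairs : Prog :=
  stateLoop (.seq (block (.iConst (.scalar 7) 0) [])
    (.seq (actionLoop (block (.rOp .add (.scalar 17) (.scalar 17) (.scalar 8))
        [.iSucc (.scalar 7)]))
      (block (.iSucc (.scalar 6)) [])))

/-- Computes the number of iterations, the number of samples, and constants. -/
def setup : Prog :=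
  .seq (block (.rConst (.scalar 8) 1) [
    .rOp .sub (.scalar 19) (.scalar 8) (.scalar 0),
    .rOp .mul (.scalar 11) (.scalar 19) (.scalar 1),
    .rConst (.scalar 15) 8,
    .rOp .div (.scalar 13) (.scalar 11) (.scalar 15),
    .rLog (.scalar 10) (.scalar 15),
    .rOp .div (.scalar 10) (.scalar 10) (.scalar 19)]) <|
  .seq (ceilLoop 3) <|
  .seq (block (.rCopy (.scalar 18) (.scalar 9)) [.iConst (.scalar 6) 0]) <|
  .seq countPairs <|
  .seq (block (.rConst (.scalar 15) 2) [
    .rOp .mul (.scalar 15) (.scalar 15) (.scalar 17),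
    .rOp .div (.scalar 15) (.scalar 15) (.scalar 2),
    .rLog (.scalar 15) (.scalar 15),
    .rConst (.scalar 10) 256,
    .rOp .mul (.scalar 10) (.scalar 18) (.scalar 10),
    .rOp .mul (.scalar 10) (.scalar 10) (.scalar 15),
    .rConst (.scalar 9) 0])
  (ceilLoop 4)

/-- Determines the best action of a state. -/
def chooseAction : Prog :=
  .seq (block (.rOp .sub (.scalar 15) (.entry 6 8) (.scalar 12)) [
    .rOp .add (.scalar 15) (.entry 5 8) (.scalar 15),
    .rOp .mul (.scalar 15) (.scalar 0) (.scalar 15),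
    .rOp .add (.scalar 14) (.entry 4 8) (.scalar 15),
    .iConst (.scalar 11) 0,
    .iConst (.scalar 7) 0]) <|
  actionLoop <|
  .seq (block (.rOp .sub (.scalar 15) (.entry 6 8) (.scalar 12)) [
    .rOp .add (.scalar 15) (.entry 5 8) (.scalar 15),
    .rOp .mul (.scalar 15) (.scalar 0) (.scalar 15),
    .rOp .add (.scalar 15) (.entry 4 8) (.scalar 15)]) <|
  .seq (.cond (.rLt (.scalar 14) (.scalar 15))
    (block (.rCopy (.scalar 14) (.scalar 15)) [.iCopy (.scalar 11) (.scalar 7)])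
    (block (.rCopy (.scalar 14) (.scalar 14)) []))
  (block (.iSucc (.scalar 7)) [.iSucc (.scalar 8)])

/-- Truncates the best action value and updates the value and policy of a state. -/
def writeState : Prog :=
  .seq (block (.rOp .add (.scalar 20) (.entry 3 6) (.scalar 11)) []) <|
  .seq (.cond (.rLt (.scalar 14) (.scalar 20))
    (block (.rCopy (.scalar 20) (.scalar 14)) [])
    (block (.rCopy (.scalar 20) (.scalar 20)) [])) <|
  .seq (.cond (.rLt (.scalar 20) (.entry 3 6))
    (block (.rConst (.entry 7 6) 0) [])
    (block (.rOp .sub (.entry 7 6) (.scalar 20) (.entry 3 6)) [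
      .rCopy (.entry 3 6) (.scalar 20),
      .iCopy (.entry 2 6) (.scalar 11)]))
  (block (.iSucc (.scalar 6)) [])

/-- Updates the values and the policy. -/
def updateStates : Prog :=
  .seq (block (.iConst (.scalar 6) 0) [.iConst (.scalar 8) 0])
    (stateLoop (.seq chooseAction writeState))

/-- Sums the increments at the answers of the model. -/
def sampleLoop : Prog :=
  .loop (.iLt (.scalar 9) (.scalar 4))
    (block (.query (.scalar 10) (.scalar 6) (.scalar 7)) [
      .rOp .add (.scalar 16) (.scalar 16) (.entry 7 10),
      .iSucc (.scalar 9)])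

/-- Updates the estimate of a pair. -/
def samplePair : Prog :=
  .seq (block (.rConst (.scalar 16) 0) [.iConst (.scalar 9) 0]) <|
  .seq sampleLoop
  (block (.rOp .div (.scalar 16) (.scalar 16) (.scalar 9)) [
    .rOp .add (.entry 6 8) (.entry 6 8) (.scalar 16),
    .iSucc (.scalar 7),
    .iSucc (.scalar 8)])

/-- Updates the estimates. -/
def updateEstimates : Prog :=
  .seq (block (.iConst (.scalar 6) 0) [.iConst (.scalar 8) 0])
    (stateLoop (.seq (block (.iConst (.scalar 7) 0) [])
      (.seq (actionLoop samplePair) (block (.iSucc (.scalar 6)) []))))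

/-- One iteration of the algorithm. -/
def iterate : Prog :=
  .seq updateStates <| .seq updateEstimates <|
    block (.rCopy (.scalar 12) (.scalar 13)) [.iSucc (.scalar 5)]

/-- The whole program. -/
def program : Prog :=
  .seq setup (.loop (.iLt (.scalar 5) (.scalar 3)) iterate)

/-! ### Rounding by counting -/

variable {O : ℕ → ℕ → ℕ → ℕ} {n : ℕ}

/-- No instruction converts between reals and indices, so an index and a real counter are
incremented together; `j < t` holds exactly for `j < ⌈t⌉₊`. The real copy is needed later for
arithmetic with the iteration and sample counts. -/
lemma ceilLoop_spec (hn : 0 < n) {d : ℕ} (hd : d < 24) {t : ℝ} {σ : Config}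
    (h8 : σ.real 8 0 = 1) (h9 : σ.real 9 0 = 0) (h10 : σ.real 10 0 = t) (h0 : σ.idx d 0 = 0) :
    Spec O n (ceilLoop d) {d} {9} 0 (3 * ⌈t⌉₊ + 1) σ fun σ' =>
      σ'.idx d 0 = ⌈t⌉₊ ∧ σ'.real 9 0 = ⌈t⌉₊ := by
  refine (Spec.loop (fun _ => 0) (fun _ => 2) ⌈t⌉₊
    (fun j σ' => σ'.idx d 0 = j ∧ σ'.real 9 0 = j) ?_ ?_ ?_ ?_ ?_).mono
    (fun _ _ h => h) subset_rfl subset_rfl (by simp) (by simp; omega)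
  · simp [h9, h0]
  · intro j _ σ' _ _
    simp [hn]
  · intro j hj σ' hf hi
    have e8 := hf.real 8 (by decide)
    have e10 := hf.real 10 (by decide)
    refine ⟨?_, Spec.block ?_ ?_ ?_ ?_ (by simp [Instr.cost]) (by simp)⟩
    · simp [hi, e10, h10, Nat.lt_ceil.1 hj]
    · simp [Inside, Instr.cells, Finset.union_subset_iff, hn, hd]
    · simp [hi, ROp.eval, e8, h8]
    · simp [Instr.iDest]
    · simp [Instr.rDest]
  · intro σ' hf hi
    have e10 := hf.real 10 (by decide)
    simp [hi, e10, h10, Nat.le_ceil]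
  · exact fun _ _ h => h

end RealRAM

/-! ### The selection rule of the program -/

/-- The least index below `k` at which `F` is maximal. -/
def firstMax (F : ℕ → ℝ) : ℕ → ℕ
  | 0 => 0
  | k + 1 => if F (firstMax F k) < F k then k else firstMax F k

lemma firstMax_lt (F : ℕ → ℝ) {k : ℕ} (hk : 0 < k) : firstMax F k < k := by
  induction k with
  | zero => exact absurd hk (lt_irrefl 0)
  | succ k ih =>
    rw [firstMax]
    split_ifs
    · omega
    · rcases k.eq_zero_or_pos with rfl | h
      · simp [firstMax]
      · have := ih h; omega

lemma le_firstMax (F : ℕ → ℝ) {j k : ℕ} (hj : j < k) : F j ≤ F (firstMax F k) := by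
  induction k with
  | zero => omega
  | succ k ih =>
    rw [firstMax]
    split_ifs with h
    · rcases Nat.lt_succ_iff_lt_or_eq.1 hj with h1 | rfl
      · exact (ih h1).trans h.le
      · exact le_rfl
    · rcases Nat.lt_succ_iff_lt_or_eq.1 hj with h1 | rfl
      · exact ih h1
      · exact not_lt.1 h

namespace DMDP

open RealRAM

variable (𝓜 : DMDP)

lemma toArray_of_lt {β : Type} [Zero β] {k : ℕ} (f : Fin k → β) {i : ℕ} (h : i < k) :
    toArray f i = f ⟨i, h⟩ := dif_pos h

/-- The rule that selects the first maximizer. -/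
def firstMaximizer : 𝓜.SelectionRule := fun s f =>
  ⟨firstMax (toArray f) (𝓜.numActions s), firstMax_lt _ (𝓜.numActions_pos s)⟩

lemma toArray_firstMaximizer (s : 𝓜.State) (f : 𝓜.Action s → ℝ) :
    toArray f (firstMax (toArray f) (𝓜.numActions s)) = f (𝓜.firstMaximizer s f) :=
  toArray_of_lt _ _

lemma isArgmaxRule_firstMaximizer : 𝓜.IsArgmaxRule 𝓜.firstMaximizer := fun s f a => by
  rw [← 𝓜.toArray_firstMaximizer s f, ← toArray_of_lt f a.2]
  exact le_firstMax (toArray f) a.2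

/-! Positions of state-action pairs -/

/-- The position of the first pair of a state. -/
def offset (k : ℕ) : ℕ := ∑ i ∈ Finset.range k, toArray 𝓜.numActions i

lemma offset_succ (s : 𝓜.State) : 𝓜.offset (s + 1) = 𝓜.offset s + 𝓜.numActions s := by
  rw [offset, Finset.sum_range_succ, toArray_of_lt _ s.2, offset]

lemma offset_numStates : 𝓜.offset 𝓜.numStates = 𝓜.Atot := by
  rw [offset, Finset.sum_range, Atot]
  exact Finset.sum_congr rfl fun s _ => toArray_of_lt _ s.2

/-- The position of a pair. -/
def position (p : 𝓜.Pair) : ℕ := finSigmaFinEquiv p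

lemma position_lt (p : 𝓜.Pair) : 𝓜.position p < 𝓜.Atot := (finSigmaFinEquiv p).2

lemma position_injective : Function.Injective 𝓜.position := fun _ _ h =>
  finSigmaFinEquiv.injective (Fin.ext h)

lemma position_eq (p : 𝓜.Pair) : 𝓜.position p = 𝓜.offset p.1 + p.2 := by
  rw [position, finSigmaFinEquiv_apply, offset, Finset.sum_range]
  congr 1
  refine Finset.sum_congr rfl fun i _ => ?_
  rw [toArray_of_lt _ (i.2.trans p.1.2)]
  rfl

/-- Comparing positions avoids transporting an action along an equality of states. -/
lemma eq_of_val_eq {p p' : 𝓜.Pair} (h1 : (p.1 : ℕ) = p'.1) (h2 : (p.2 : ℕ) = p'.2) : p = p' :=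
  𝓜.position_injective (by rw [position_eq, position_eq, h1, h2])

lemma pairArray_position (f : 𝓜.Pair → ℝ) (p : 𝓜.Pair) :
    𝓜.pairArray f (𝓜.position p) = f p := by
  have h : 𝓜.position p < ∑ s, 𝓜.numActions s := 𝓜.position_lt p
  rw [pairArray, toArray_of_lt _ h]
  exact congrArg f (finSigmaFinEquiv.symm_apply_apply p)

lemma numStates_le_Atot : 𝓜.numStates ≤ 𝓜.Atot := by
  calc 𝓜.numStates = ∑ _s : 𝓜.State, 1 := by simp
    _ ≤ 𝓜.Atot := Finset.sum_le_sum fun s _ => 𝓜.numActions_pos s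

lemma state_lt_Atot (s : 𝓜.State) : (s : ℕ) < 𝓜.Atot := s.2.trans_le 𝓜.numStates_le_Atot

/-- The total cost of a loop over the states. -/
lemma sum_cost_le (a b : ℕ) :
    ∑ i ∈ Finset.range 𝓜.numStates, (a + b * toArray 𝓜.numActions i) ≤ (a + b) * 𝓜.Atot := by
  rw [Finset.sum_add_distrib, ← Finset.mul_sum, Finset.sum_const, Finset.card_range, smul_eq_mul]
  have h1 := 𝓜.offset_numStates
  rw [offset] at h1
  rw [h1, add_mul, mul_comm _ a]
  exact Nat.add_le_add_right (Nat.mul_le_mul_left a 𝓜.numStates_le_Atot) _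

/-! ### Loops over states and actions -/

variable {𝓜} {O : ℕ → ℕ → ℕ → ℕ} {σ : Config}

/-- A loop over the states, with costs that are linear in the number of actions. -/
lemma stateLoop_spec {p : Prog} {DI DR : Finset ℕ} (q a b : ℕ) (I : ℕ → Config → Prop)
    (h6 : σ.idx 6 0 = 0) (h0 : I 0 σ) (hS : σ.idx 0 0 = 𝓜.numStates)
    (hcharge : ∀ k σ' cells, I k σ' → I k (σ'.charge cells))
    (hbody : ∀ (s : 𝓜.State) σ' t u, Frame 𝓜.Atot DI DR t u σ σ' → σ'.idx 6 0 = s → I s σ' →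
      Spec O 𝓜.Atot p DI DR (q * 𝓜.numActions s) (a + b * 𝓜.numActions s) σ' fun σ'' =>
        σ''.idx 6 0 = s + 1 ∧ I (s + 1) σ'')
    (hDI : 0 ∉ DI := by decide) :
    Spec O 𝓜.Atot (stateLoop p) DI DR (q * 𝓜.Atot) ((a + 1 + b) * 𝓜.Atot + 1) σ
      (I 𝓜.numStates) := by
  have hn := 𝓜.Atot_pos
  refine (Spec.loop (fun k => q * toArray 𝓜.numActions k)
    (fun k => a + b * toArray 𝓜.numActions k) 𝓜.numStates
    (fun k σ' => σ'.idx 6 0 = k ∧ I k σ') ⟨h6, h0⟩ ?_ ?_ ?_ ?_).mono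
    (fun _ _ h => h.2) subset_rfl subset_rfl ?_ ?_
  · intro k _ σ' _ _
    simp [hn]
  · intro k hk σ' hf hi
    have e0 := hf.idx 0 hDI
    refine ⟨by simp [hi, e0, hS, hk], ?_⟩
    have hc : (Test.iLt (.scalar 6) (.scalar 0)).cells σ' ⊆ workspace 𝓜.Atot := by simp [hn]
    have := hbody ⟨k, hk⟩ _ _ _ (hf.trans (frame_charge (DI := ∅) (DR := ∅) hc) (by simp)
      (by simp) le_rfl le_rfl) hi.1 (hcharge _ _ _ hi.2)
    simpa [toArray_of_lt _ hk] using this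
  · intro σ' hf hi
    have e0 := hf.idx 0 hDI
    simp [hi, e0, hS]
  · exact fun σ' cells h => ⟨h.1, hcharge _ _ _ h.2⟩
  · rw [← Finset.mul_sum, ← offset, offset_numStates]
  · have := 𝓜.sum_cost_le (a + 1) b
    simp only [add_right_comm _ _ 1]
    omega

/-- A loop over the actions of the state `s`. -/
lemma actionLoop_spec {p : Prog} {DI DR : Finset ℕ} {s : 𝓜.State} (q c : ℕ)
    (I : ℕ → Config → Prop) (h6 : σ.idx 6 0 = s) (h7 : σ.idx 7 0 = 0) (h0 : I 0 σ)
    (hA : σ.idx 1 = toArray 𝓜.numActions)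
    (hcharge : ∀ k σ' cells, I k σ' → I k (σ'.charge cells))
    (hbody : ∀ (a : 𝓜.Action s) σ' t u, Frame 𝓜.Atot DI DR t u σ σ' → σ'.idx 7 0 = a → I a σ' →
      Spec O 𝓜.Atot p DI DR q c σ' fun σ'' => σ''.idx 7 0 = a + 1 ∧ I (a + 1) σ'')
    (hDI : 1 ∉ DI := by decide) (hDI' : 6 ∉ DI := by decide) :
    Spec O 𝓜.Atot (actionLoop p) DI DR (q * 𝓜.numActions s) ((c + 1) * 𝓜.numActions s + 1) σ
      (I (𝓜.numActions s)) := by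
  have hn := 𝓜.Atot_pos
  refine (Spec.loop (fun _ => q) (fun _ => c) (𝓜.numActions s)
    (fun k σ' => σ'.idx 7 0 = k ∧ I k σ') ⟨h7, h0⟩ ?_ ?_ ?_ ?_).mono
    (fun _ _ h => h.2) subset_rfl subset_rfl ?_ ?_
  · intro k _ σ' hf _
    have e6 := hf.idx 6 hDI'
    simp [hn, e6, h6, 𝓜.state_lt_Atot]
  · intro k hk σ' hf hi
    have e1 := hf.idx 1 hDI
    have e6 := hf.idx 6 hDI'
    refine ⟨by simp [hi, e1, e6, h6, hA, toArray_of_lt, hk], ?_⟩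
    have hc : (Test.iLt (.scalar 7) (.entry 1 6)).cells σ' ⊆ workspace 𝓜.Atot := by
      simp [hn, e6, h6, 𝓜.state_lt_Atot]
    exact hbody ⟨k, hk⟩ _ _ _ (hf.trans (frame_charge (DI := ∅) (DR := ∅) hc) (by simp)
      (by simp) le_rfl le_rfl) hi.1 (hcharge _ _ _ hi.2)
  · intro σ' hf hi
    have e1 := hf.idx 1 hDI
    have e6 := hf.idx 6 hDI'
    simp [hi, e1, e6, h6, hA, toArray_of_lt]
  · exact fun σ' cells h => ⟨h.1, hcharge _ _ _ h.2⟩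
  · simp [mul_comm]
  · simp [mul_comm]

lemma countPairs_spec (hS : σ.idx 0 0 = 𝓜.numStates) (hA : σ.idx 1 = toArray 𝓜.numActions)
    (h6 : σ.idx 6 0 = 0) (h8 : σ.real 8 0 = 1) (h17 : σ.real 17 0 = 0) :
    Spec O 𝓜.Atot countPairs {6, 7} {17} 0 (8 * 𝓜.Atot + 1) σ fun σ' =>
      σ'.real 17 0 = 𝓜.Atot := by
  have hn := 𝓜.Atot_pos
  refine (stateLoop_spec 0 3 3 (fun k σ' => σ'.real 17 0 = 𝓜.offset k) h6 (by simp [h17, offset])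
    hS (fun _ _ _ h => h) fun s σ₁ _ _ f₁ h6 hi => ?_).mono
    (fun _ _ h => by rw [h, offset_numStates]) subset_rfl subset_rfl
  refine Spec.seq (DI₁ := {7}) (DR₁ := ∅) (q₁ := 0) (k₁ := 1) (DI₂ := {6, 7}) (DR₂ := {17})
    (q₂ := 0) (k₂ := 3 * 𝓜.numActions s + 2) (Q₁ := fun σ' => σ'.idx 7 0 = 0)
    (Spec.block (by simp [Inside, Instr.cells, hn]) (by simp)) fun σ₂ f₂ h7 => ?_
  refine Spec.seq (DI₁ := {7}) (DR₁ := {17}) (DI₂ := {6}) (DR₂ := ∅) (q₂ := 0) (k₂ := 1)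
    (actionLoop_spec (s := s) 0 2 (fun j σ' => σ'.real 17 0 = 𝓜.offset s + j)
      ?_ h7 ?_ ?_ (fun _ _ _ h => h) fun a σ₃ _ _ f₃ h7' hi' => ?_) fun σ₄ f₄ h17' => ?_
  · rw [f₂.idx 6 (by decide), h6]
  · simp [f₂.real 17 (by decide), hi]
  · rw [f₂.idx 1 (by decide), f₁.idx 1 (by decide), hA]
  · have e8 : σ₃.real 8 0 = 1 := by
      rw [f₃.real 8 (by decide), f₂.real 8 (by decide), f₁.real 8 (by decide), h8]
    refine Spec.block ?_ ?_
    · simp [Inside, Instr.cells, Finset.union_subset_iff, hn]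
    · simp [ROp.eval, h7', hi', e8, add_assoc]
  · have e6 : σ₄.idx 6 0 = s := by
      rw [f₄.idx 6 (by decide), f₂.idx 6 (by decide), h6]
    refine Spec.block ?_ ?_
    · simp [Inside, Instr.cells, hn]
    · simp [e6, h17', offset_succ]

end DMDP

/-! ### Updating values and policy -/

namespace DMDP

open RealRAM

variable {𝓜 : DMDP} {O : ℕ → ℕ → ℕ → ℕ} {σ : Config}

/-- The incumbent is preloaded with action `0`, and the loop examines that action again; this
matches `firstMax F 0 = 0`, so the invariant holds from the start. The strict comparison keeps the
incumbent on ties and hence finds the first maximizer. -/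
lemma chooseAction_spec {s : 𝓜.State} (f : 𝓜.Action s → ℝ)
    (h6 : σ.idx 6 0 = s) (h8 : σ.idx 8 0 = 𝓜.offset s) (hA : σ.idx 1 = toArray 𝓜.numActions)
    (hf : ∀ a : 𝓜.Action s, σ.real 4 (𝓜.offset s + a) + σ.real 0 0 * (σ.real 5 (𝓜.offset s + a) +
      (σ.real 6 (𝓜.offset s + a) - σ.real 12 0)) = f a) :
    Spec O 𝓜.Atot chooseAction {7, 8, 11} {14, 15} 0 (10 * 𝓜.numActions s + 7) σ fun σ' =>
      σ'.idx 8 0 = 𝓜.offset (s + 1) ∧ σ'.idx 11 0 = 𝓜.firstMaximizer s f ∧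
        σ'.real 14 0 = f (𝓜.firstMaximizer s f) := by
  have hn := 𝓜.Atot_pos
  have hpos : ∀ a : 𝓜.Action s, 𝓜.offset s + a < 𝓜.Atot := fun a => by
    have := 𝓜.position_lt ⟨s, a⟩
    rwa [position_eq] at this
  set F : ℕ → ℝ := toArray f with hF
  have hfirst : 𝓜.offset s < 𝓜.Atot := hpos ⟨0, 𝓜.numActions_pos s⟩
  refine Spec.seq (DI₁ := {7, 11}) (DR₁ := {14, 15}) (q₁ := 0) (k₁ := 6) (Q₁ := fun σ' =>
    σ'.idx 7 0 = 0 ∧ σ'.idx 11 0 = 0 ∧ σ'.real 14 0 = F 0)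
    (Spec.block ?_ ?_) fun σ₁ f₁ i₁ => (actionLoop_spec (DI := {7, 8, 11}) (DR := {14, 15}) (s := s)
      0 9 (fun j σ' => σ'.idx 8 0 = 𝓜.offset s + j ∧ σ'.idx 11 0 = firstMax F j ∧
        σ'.real 14 0 = F (firstMax F j)) ?_ i₁.1 ?_ ?_ (fun _ _ _ h => h)
        fun a σ₂ _ _ f₂ h7 i₂ => ?_).mono (q := 0) (k := 10 * 𝓜.numActions s + 1)
      (fun σ' _ h => ⟨?_, h.2.1, ?_⟩) subset_rfl subset_rfl
  · simp [Inside, Instr.cells, Finset.union_subset_iff, hn, h8, hfirst]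
  · have := hf ⟨0, 𝓜.numActions_pos s⟩
    simp only [add_zero] at this
    simp [ROp.eval, h8, hF, toArray_of_lt, 𝓜.numActions_pos s, this]
  · rw [f₁.idx 6 (by decide), h6]
  · simp [f₁.idx 8 (by decide), h8, i₁, firstMax]
  · rw [f₁.idx 1 (by decide), hA]
  · have e : σ₂.real 4 (𝓜.offset s + a) + σ₂.real 0 0 * (σ₂.real 5 (𝓜.offset s + a) +
        (σ₂.real 6 (𝓜.offset s + a) - σ₂.real 12 0)) = F a := by
      rw [f₂.real 4 (by decide), f₂.real 0 (by decide), f₂.real 5 (by decide),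
        f₂.real 6 (by decide), f₂.real 12 (by decide), f₁.real 4 (by decide),
        f₁.real 0 (by decide), f₁.real 5 (by decide), f₁.real 6 (by decide),
        f₁.real 12 (by decide), hf, hF, toArray_of_lt f a.2]
    obtain ⟨i8, i11, i14⟩ := i₂
    refine Spec.seq (DI₁ := ∅) (DR₁ := {15}) (q₁ := 0) (k₁ := 4) (DI₂ := {7, 8, 11})
      (DR₂ := {14}) (q₂ := 0) (k₂ := 5) (Q₁ := fun σ' => σ'.real 15 0 = F a)
      (Spec.block ?_ ?_) fun σ₃ f₃ i₃ => ?_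
    · simp [Inside, Instr.cells, Finset.union_subset_iff, hn, i8, hpos a]
    · simp [ROp.eval, i8, e]
    have j7 := f₃.idx 7 (by decide)
    have j8 := f₃.idx 8 (by decide)
    have j11 := f₃.idx 11 (by decide)
    have j14 := f₃.real 14 (by decide)
    refine Spec.seq (DI₁ := {11}) (DR₁ := {14}) (q₁ := 0) (DI₂ := {7, 8})
      (DR₂ := ∅) (q₂ := 0) (k₂ := 2) (Q₁ := fun σ' => σ'.idx 11 0 = firstMax F (a + 1) ∧
        σ'.real 14 0 = F (firstMax F (a + 1)))
      (Spec.cond (k := 2) ?_ (fun hlt => Spec.block ?_ ?_) fun hlt => Spec.block ?_ ?_)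
      fun σ₄ f₄ i₄ => Spec.block ?_ ?_
    · simp [hn]
    · simp [Inside, Instr.cells, Finset.union_subset_iff, hn]
    · simp only [rLt_holds, rVal_scalar, j14, i₃, i14] at hlt
      simp [firstMax, hlt, i₃, j7, h7]
    · simp [Inside, Instr.cells, hn]
    · simp only [rLt_holds, rVal_scalar, j14, i₃, i14] at hlt
      simp [firstMax, hlt, j11, i11, j14, i14]
    · simp [Inside, Instr.cells, hn]
    · simp [f₄.idx 7 (by decide), f₄.idx 8 (by decide), j7, h7, j8, i8, i₄, add_assoc]
  · rw [h.1, offset_succ]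
  · rw [h.2.2, hF, toArray_firstMaximizer]

/-- The old entry is kept only when the candidate is strictly smaller, so on equality the policy
changes, as the algorithm prescribes. In the kept case the increment is reset to zero because its
cell may hold a value from the previous iteration. -/
lemma writeState_spec {s : 𝓜.State} (h6 : σ.idx 6 0 = s) {t : ℝ}
    (ht : min (σ.real 14 0) (σ.real 3 s + σ.real 11 0) = t) :
    Spec O 𝓜.Atot writeState {2, 6} {3, 7, 20} 0 8 σ fun σ' =>
      σ'.idx 6 0 = s + 1 ∧
      (∀ i, σ'.real 3 i = if i = s ∧ σ.real 3 s ≤ t then t else σ.real 3 i) ∧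
      (∀ i, σ'.idx 2 i = if i = s ∧ σ.real 3 s ≤ t then σ.idx 11 0 else σ.idx 2 i) ∧
      (∀ i, σ'.real 7 i = if i = s then (if σ.real 3 s ≤ t then t - σ.real 3 s else 0)
        else σ.real 7 i) := by
  have hn := 𝓜.Atot_pos
  have hs := 𝓜.state_lt_Atot s
  refine Spec.seq (DI₁ := ∅) (DR₁ := {20}) (q₁ := 0) (k₁ := 1) (DI₂ := {2, 6})
    (DR₂ := {3, 7, 20}) (q₂ := 0) (k₂ := 7)
    (Q₁ := fun σ' => σ'.real 20 0 = σ.real 3 s + σ.real 11 0)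
    (Spec.block ?_ ?_) fun σ₁ f₁ i₁ => ?_
  · simp [Inside, Instr.cells, Finset.union_subset_iff, hn, h6, hs]
  · simp [ROp.eval, h6]
  have a14 := f₁.real 14 (by decide)
  refine Spec.seq (DI₁ := ∅) (DR₁ := {20}) (q₁ := 0) (DI₂ := {2, 6})
    (DR₂ := {3, 7}) (q₂ := 0) (k₂ := 5) (Q₁ := fun σ' => σ'.real 20 0 = t)
    (Spec.cond (k := 1) ?_ (fun hlt => Spec.block ?_ ?_) fun hlt => Spec.block ?_ ?_)
    fun σ₂ f₂ i₂ => ?_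
  · simp [hn]
  · simp [Inside, Instr.cells, Finset.union_subset_iff, hn]
  · simp only [rLt_holds, rVal_scalar, a14, i₁] at hlt
    simp [a14, ← ht, hlt.le]
  · simp [Inside, Instr.cells, hn]
  · simp only [rLt_holds, rVal_scalar, a14, i₁, not_lt] at hlt
    simp [i₁, ← ht, hlt]
  have e6 : σ₂.idx 6 0 = s := by rw [f₂.idx 6 (by decide), f₁.idx 6 (by decide), h6]
  have e3 : σ₂.real 3 = σ.real 3 := by rw [f₂.real 3 (by decide), f₁.real 3 (by decide)]
  have e7 : σ₂.real 7 = σ.real 7 := by rw [f₂.real 7 (by decide), f₁.real 7 (by decide)]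
  have e2 : σ₂.idx 2 = σ.idx 2 := by rw [f₂.idx 2 (by decide), f₁.idx 2 (by decide)]
  have e11 : σ₂.idx 11 = σ.idx 11 := by rw [f₂.idx 11 (by decide), f₁.idx 11 (by decide)]
  refine Spec.seq (DI₁ := {2}) (DR₁ := {3, 7}) (q₁ := 0) (DI₂ := {6})
    (DR₂ := ∅) (q₂ := 0) (k₂ := 1) (Q₁ := fun σ' =>
      (∀ i, σ'.real 3 i = if i = s ∧ σ.real 3 s ≤ t then t else σ.real 3 i) ∧
      (∀ i, σ'.idx 2 i = if i = s ∧ σ.real 3 s ≤ t then σ.idx 11 0 else σ.idx 2 i) ∧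
      (∀ i, σ'.real 7 i = if i = s then (if σ.real 3 s ≤ t then t - σ.real 3 s else 0)
        else σ.real 7 i))
    (Spec.cond (k := 3) ?_ (fun hlt => Spec.block ?_ ?_) fun hlt => Spec.block ?_ ?_)
    fun σ₃ f₃ i₃ => Spec.block ?_ ?_
  · simp [hn, e6, hs]
  · simp [Inside, Instr.cells, hn, e6, hs]
  · simp only [rLt_holds, rVal_scalar, rVal_entry, e6, e3, i₂] at hlt
    simp [e6, e3, e2, e7, not_le.2 hlt]
  · simp [Inside, Instr.cells, Finset.union_subset_iff, hn, e6, hs]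
  · simp only [rLt_holds, rVal_scalar, rVal_entry, e6, e3, i₂, not_lt] at hlt
    simp [ROp.eval, e6, e3, e2, e7, e11, i₂, hlt]
  · simp [Inside, Instr.cells, hn]
  · simp [f₃.idx 6 (by decide), e6, i₃]

/-- In-place updating is sound because action values depend on rewards, `x` and the estimates, but
not on the values of other states. The invariant therefore has finished states below `k` and
untouched ones from `k` on. -/
lemma updateStates_spec {x : 𝓜.Pair → ℝ} {α : ℝ} {M ℓ : ℕ} {ω : 𝓜.Tape} {I : 𝓜.Iterate}
    (hS : σ.idx 0 0 = 𝓜.numStates) (hA : σ.idx 1 = toArray 𝓜.numActions)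
    (hγ : σ.real 0 0 = 𝓜.γ) (hr : σ.real 4 = 𝓜.pairArray fun p => 𝓜.reward p.1 p.2)
    (hx : σ.real 5 = 𝓜.pairArray x) (hc : σ.real 11 0 = (1 - 𝓜.γ) * α)
    (hv : ∀ s : 𝓜.State, σ.real 3 s = I.v s) (hπ : ∀ s : 𝓜.State, σ.idx 2 s = I.π s)
    (hg : ∀ p, σ.real 6 (𝓜.position p) - σ.real 12 0 = I.gHat p) :
    Spec O 𝓜.Atot updateStates {2, 6, 7, 8, 11} {3, 7, 14, 15, 20} 0 (28 * 𝓜.Atot + 1) σ fun σ' =>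
      ∀ s : 𝓜.State, σ'.real 3 s = (𝓜.iteration 𝓜.firstMaximizer x α M ω ℓ I).v s ∧
        σ'.idx 2 s = (𝓜.iteration 𝓜.firstMaximizer x α M ω ℓ I).π s ∧
        σ'.real 7 s = (𝓜.iteration 𝓜.firstMaximizer x α M ω ℓ I).v s - I.v s := by
  have hn := 𝓜.Atot_pos
  set J := 𝓜.iteration 𝓜.firstMaximizer x α M ω ℓ I with hJ
  refine Spec.seq (DI₁ := {6, 8}) (DR₁ := ∅) (q₁ := 0) (k₁ := 2) (Q₁ := fun σ' =>
    σ'.idx 6 0 = 0 ∧ σ'.idx 8 0 = 0) (DI₂ := {2, 6, 7, 8, 11}) (DR₂ := {3, 7, 14, 15, 20})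
    (q₂ := 0) (k₂ := 26 * 𝓜.Atot + 1)
    (Spec.block ?_ ?_) fun σ₁ f₁ i₁ => (stateLoop_spec 0 15 10 (fun k σ' =>
      σ'.idx 8 0 = 𝓜.offset k ∧ ∀ s : 𝓜.State,
        ((s : ℕ) < k → σ'.real 3 s = J.v s ∧ σ'.idx 2 s = J.π s ∧ σ'.real 7 s = J.v s - I.v s) ∧
        (k ≤ s → σ'.real 3 s = I.v s ∧ σ'.idx 2 s = I.π s)) i₁.1 ?_ ?_ (fun _ _ _ h => h)
      fun s σ₂ _ _ f₂ h6 i₂ => ?_).mono (fun σ' _ h s => (h.2 s).1 s.2) subset_rfl subset_rfl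
  · simp [Inside, Instr.cells, hn]
  · simp
  · simp [i₁, offset, f₁.real 3 (by decide), f₁.idx 2 (by decide), hv, hπ]
  · rw [f₁.idx 0 (by decide), hS]
  · set f : 𝓜.Action s → ℝ := fun a => 𝓜.actionValue x I ⟨s, a⟩ with hf
    obtain ⟨i8, i₂⟩ := i₂
    have e11 : σ₂.real 11 0 = (1 - 𝓜.γ) * α := by
      rw [f₂.real 11 (by decide), f₁.real 11 (by decide), hc]
    refine Spec.seq (DI₂ := {2, 6}) (DR₂ := {3, 7, 20}) (q₂ := 0) (k₂ := 8)
      (chooseAction_spec f h6 i8 ?_ fun a => ?_) fun σ₃ f₃ i₃ =>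
      (writeState_spec (t := min (⨆ a, f a) (I.v s + (1 - 𝓜.γ) * α)) (s := s) ?_ ?_).mono
      (fun σ₄ f₄ i₄ => ⟨i₄.1, ?_, fun s' => ?_⟩)
    · rw [f₂.idx 1 (by decide), f₁.idx 1 (by decide), hA]
    · have hp : 𝓜.offset s + a = 𝓜.position ⟨s, a⟩ := (𝓜.position_eq ⟨s, a⟩).symm
      rw [f₂.real 4 (by decide), f₂.real 0 (by decide), f₂.real 5 (by decide),
        f₂.real 6 (by decide), f₂.real 12 (by decide), f₁.real 4 (by decide),
        f₁.real 0 (by decide), f₁.real 5 (by decide), f₁.real 6 (by decide),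
        f₁.real 12 (by decide), hp, hr, hγ, hx, hg, pairArray_position, pairArray_position]
      rfl
    · rw [f₃.idx 6 (by decide), h6]
    · rw [i₃.2.2, f₃.real 3 (by decide), f₃.real 11 (by decide), e11, ((i₂ s).2 le_rfl).1]
      congr 1
      exact le_antisymm (le_ciSup (Set.finite_range f).bddAbove _)
        (ciSup_le fun a => 𝓜.isArgmaxRule_firstMaximizer s f a)
    · rw [f₄.idx 8 (by decide), i₃.1]
    · have hJv : J.v s = if min (⨆ a, f a) (I.v s + (1 - 𝓜.γ) * α) ≥ I.v s then
        min (⨆ a, f a) (I.v s + (1 - 𝓜.γ) * α) else I.v s := rfl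
      have hJπ : J.π s = if min (⨆ a, f a) (I.v s + (1 - 𝓜.γ) * α) ≥ I.v s then
        𝓜.firstMaximizer s f else I.π s := rfl
      obtain ⟨-, k3, k2, k7⟩ := i₄
      rw [f₃.real 3 (by decide), ((i₂ s).2 le_rfl).1] at k3 k2 k7
      rw [f₃.idx 2 (by decide)] at k2
      rw [f₃.real 7 (by decide)] at k7
      rw [k3, k2, k7]
      by_cases hs : s' = s
      · subst hs
        refine ⟨fun _ => ?_, fun h => by omega⟩
        rw [hJv, hJπ]
        simp only [true_and, if_true, ge_iff_le, i₃.2.1, ((i₂ s').2 le_rfl).1,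
          ((i₂ s').2 le_rfl).2]
        split_ifs <;> simp
      · have hs' : (s' : ℕ) ≠ s := fun h => hs (Fin.ext h)
        simp only [hs', false_and, if_false]
        exact ⟨fun h => (i₂ s').1 (by omega), fun h => (i₂ s').2 (by omega)⟩

end DMDP

/-! ### Sampling and updating the estimates -/

namespace DMDP

open RealRAM

variable {𝓜 : DMDP} {σ : Config} {ω : 𝓜.Tape}

lemma oracle_apply (ω : 𝓜.Tape) (p : 𝓜.Pair) (j : ℕ) : 𝓜.oracle ω p.1 p.2 j = ω p j := by
  have h : ∃ hs : (p.1 : ℕ) < 𝓜.numStates, (p.2 : ℕ) < 𝓜.numActions ⟨p.1, hs⟩ :=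
    ⟨p.1.2, p.2.2⟩
  rw [oracle, dif_pos h]

/-- The query counter `m` of the pair determines which stretch of the tape is consumed. With `m = ℓ
M` these are exactly the draws that the algorithm assigns to iteration `ℓ`. -/
lemma sampleLoop_spec {p : 𝓜.Pair} {M m : ℕ} {u : 𝓜.State → ℝ} (h6 : σ.idx 6 0 = p.1)
    (h7 : σ.idx 7 0 = p.2) (h9 : σ.idx 9 0 = 0) (h4 : σ.idx 4 0 = M) (h16 : σ.real 16 0 = 0)
    (hu : ∀ s : 𝓜.State, σ.real 7 s = u s) (hm : σ.asked p.1 p.2 = m) :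
    Spec (𝓜.oracle ω) 𝓜.Atot sampleLoop {9, 10} {16} M (4 * M + 1) σ fun σ' =>
      σ'.real 16 0 = ∑ j ∈ Finset.range M, u (ω p (m + j)) ∧
      ∀ b i, σ'.asked b i = if b = p.1 ∧ i = p.2 then m + M else σ.asked b i := by
  have hn := 𝓜.Atot_pos
  refine (Spec.loop (fun _ => 1) (fun _ => 3) M (fun k σ' => σ'.idx 9 0 = k ∧
    σ'.real 16 0 = ∑ j ∈ Finset.range k, u (ω p (m + j)) ∧
    ∀ b i, σ'.asked b i = if b = p.1 ∧ i = p.2 then m + k else σ.asked b i)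
    ⟨h9, by simp [h16], fun b i => ?_⟩ ?_ ?_ ?_ ?_).mono
    (fun _ _ h => h.2) subset_rfl subset_rfl (by simp) (by simp; omega)
  · split_ifs with h
    · rw [h.1, h.2, hm, add_zero]
    · rfl
  · intro k _ σ' _ _
    simp [hn]
  · intro k hk σ' hf ⟨i9, i16, ia⟩
    have e4 := hf.idx 4 (by decide)
    have e6 := hf.idx 6 (by decide)
    have e7 := hf.idx 7 (by decide)
    have er7 := hf.real 7 (by decide)
    refine ⟨by simp [i9, e4, h4, hk], Spec.block ?_ ?_⟩
    · simp [Inside, Instr.cells, Finset.union_subset_iff, hn, e6, e7, h6, h7, oracle_apply,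
        𝓜.state_lt_Atot]
    · refine ⟨by simp [i9], ?_, fun b i => ?_⟩
      · simp [ROp.eval, e6, e7, h6, h7, ia, oracle_apply, i16, er7, hu, Finset.sum_range_succ]
      · simp only [run_cons, run_nil, step_iSucc_asked, step_rOp_asked, step_query_asked,
          iVal_scalar, charge_idx, charge_asked, e6, e7, h6, h7, ia]
        split_ifs <;> simp_all [add_assoc]
  · intro σ' hf hi
    have e4 := hf.idx 4 (by decide)
    simp [hi, e4, h4]
  · exact fun _ _ h => h

lemma samplePair_spec {p : 𝓜.Pair} {M m : ℕ} {u : 𝓜.State → ℝ} (h6 : σ.idx 6 0 = p.1)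
    (h7 : σ.idx 7 0 = p.2) (h8 : σ.idx 8 0 = 𝓜.position p) (h4 : σ.idx 4 0 = M)
    (h9 : σ.real 9 0 = M) (hu : ∀ s : 𝓜.State, σ.real 7 s = u s) (hm : σ.asked p.1 p.2 = m) :
    Spec (𝓜.oracle ω) 𝓜.Atot samplePair {7, 8, 9, 10} {6, 16} M (4 * M + 7) σ fun σ' =>
      σ'.idx 7 0 = p.2 + 1 ∧ σ'.idx 8 0 = 𝓜.position p + 1 ∧
      (∀ i, σ'.real 6 i = if i = 𝓜.position p then
        σ.real 6 i + (1 / (M : ℝ)) * ∑ j ∈ Finset.range M, u (ω p (m + j)) else σ.real 6 i) ∧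
      ∀ b i, σ'.asked b i = if b = p.1 ∧ i = p.2 then m + M else σ.asked b i := by
  have hn := 𝓜.Atot_pos
  refine Spec.seq (DI₁ := {9}) (DR₁ := {16}) (q₁ := 0) (k₁ := 2) (Q₁ := fun σ' =>
    σ'.idx 9 0 = 0 ∧ σ'.real 16 0 = 0) (DI₂ := {7, 8, 9, 10}) (DR₂ := {6, 16}) (q₂ := M)
    (k₂ := 4 * M + 5) (Spec.block ?_ ?_) fun σ₁ f₁ i₁ => ?_
  · simp [Inside, Instr.cells, hn]
  · simp
  refine Spec.seq (DI₂ := {7, 8}) (DR₂ := {6, 16}) (q₂ := 0)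
    (k₂ := 4) (sampleLoop_spec (M := M) (p := p) (m := m) (u := u) ?_ ?_ i₁.1 ?_ i₁.2 ?_ ?_)
    fun σ₂ f₂ i₂ => Spec.block ?_ ?_
  · rw [f₁.idx 6 (by decide), h6]
  · rw [f₁.idx 7 (by decide), h7]
  · rw [f₁.idx 4 (by decide), h4]
  · rw [f₁.real 7 (by decide)]; exact hu
  · rw [f₁.asked rfl, hm]
  · simp [Inside, Instr.cells, Finset.union_subset_iff, hn, f₂.idx 8 (by decide),
      f₁.idx 8 (by decide), h8, position_lt]
  · have e8 : σ₂.idx 8 0 = 𝓜.position p := by rw [f₂.idx 8 (by decide), f₁.idx 8 (by decide), h8]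
    have e7 : σ₂.idx 7 0 = p.2 := by rw [f₂.idx 7 (by decide), f₁.idx 7 (by decide), h7]
    have er6 : σ₂.real 6 = σ.real 6 := by rw [f₂.real 6 (by decide), f₁.real 6 (by decide)]
    have er9 : σ₂.real 9 0 = M := by rw [f₂.real 9 (by decide), f₁.real 9 (by decide), h9]
    refine ⟨by simp [e7], by simp [e8], fun i => ?_, fun b i => ?_⟩
    · simp only [run_cons, run_nil, step_iSucc_real, step_rOp_real, step_rOp_idx, arr_entry,
        arr_scalar, pos_entry, pos_scalar, rVal_entry, rVal_scalar, ROp.eval, e8, er6, er9, i₂.1]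
      by_cases hi : i = 𝓜.position p
      · simp [hi]
        ring
      · simp [hi]
    · simp only [run_cons, run_nil, step_iSucc_asked, step_rOp_asked, i₂.2, f₁.asked rfl]

lemma updateEstimates_spec {M m : ℕ} {u : 𝓜.State → ℝ} {g : 𝓜.Pair → ℝ}
    (hS : σ.idx 0 0 = 𝓜.numStates) (hA : σ.idx 1 = toArray 𝓜.numActions) (h4 : σ.idx 4 0 = M)
    (h9 : σ.real 9 0 = M) (hu : ∀ s : 𝓜.State, σ.real 7 s = u s)
    (hg : ∀ p, σ.real 6 (𝓜.position p) = g p)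
    (hm : ∀ p : 𝓜.Pair, σ.asked p.1 p.2 = m) :
    Spec (𝓜.oracle ω) 𝓜.Atot updateEstimates {6, 7, 8, 9, 10} {6, 16} (M * 𝓜.Atot)
      ((4 * M + 12) * 𝓜.Atot + 3) σ fun σ' =>
        (∀ p, σ'.real 6 (𝓜.position p) =
          g p + 𝓜.apxUtility u M 0 (fun p j => ω p (m + j)) p) ∧
        ∀ p : 𝓜.Pair, σ'.asked p.1 p.2 = m + M := by
  have hn := 𝓜.Atot_pos
  -- Listing pairs by position lets one invariant serve both nested loops: the pairs at positions
  -- below `P` are finished, with `P` the offset of the state, plus the action index in the inner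
  -- loop.
  let I : ℕ → Config → Prop := fun P σ' => σ'.idx 8 0 = P ∧ ∀ p : 𝓜.Pair,
    (σ'.real 6 (𝓜.position p) = if 𝓜.position p < P then
      g p + 𝓜.apxUtility u M 0 (fun p j => ω p (m + j)) p else g p) ∧
    σ'.asked p.1 p.2 = if 𝓜.position p < P then m + M else m
  refine Spec.seq (DI₁ := {6, 8}) (DR₁ := ∅) (q₁ := 0) (k₁ := 2) (Q₁ := fun σ' =>
    σ'.idx 6 0 = 0 ∧ σ'.idx 8 0 = 0) (DI₂ := {6, 7, 8, 9, 10}) (DR₂ := {6, 16})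
    (q₂ := M * 𝓜.Atot) (k₂ := (4 * M + 12) * 𝓜.Atot + 1)
    (Spec.block ?_ ?_) fun σ₁ f₁ i₁ => (stateLoop_spec M 3 (4 * M + 8)
      (fun k => I (𝓜.offset k)) i₁.1 ⟨?_, fun p => ⟨?_, ?_⟩⟩ ?_ (fun _ _ _ h => h)
      fun s σ₂ _ _ f₂ h6 i₂ => ?_).mono (fun σ' _ h => ?_) subset_rfl subset_rfl le_rfl ?_
  · simp [Inside, Instr.cells, hn]
  · simp
  · simp [i₁, offset]
  · simp [offset, f₁.real 6 (by decide), hg]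
  · simp [offset, f₁.asked rfl, hm]
  · rw [f₁.idx 0 (by decide), hS]
  · refine Spec.seq (DI₁ := {7}) (DR₁ := ∅) (q₁ := 0) (k₁ := 1) (DI₂ := {6, 7, 8, 9, 10})
      (DR₂ := {6, 16}) (q₂ := M * 𝓜.numActions s) (k₂ := 2 + (4 * M + 8) * 𝓜.numActions s)
      (Q₁ := fun σ' => σ'.idx 7 0 = 0)
      (Spec.block (by simp [Inside, Instr.cells, hn]) (by simp)) fun σ₃ f₃ i₃ => ?_
    refine Spec.seq (DI₁ := {7, 8, 9, 10}) (DR₁ := {6, 16}) (DI₂ := {6}) (DR₂ := ∅) (q₂ := 0)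
      (k₁ := (4 * M + 8) * 𝓜.numActions s + 1) (k₂ := 1)
      (actionLoop_spec (s := s) M (4 * M + 7) (fun k => I (𝓜.offset s + k)) ?_ i₃
        ⟨?_, fun p => ?_⟩ ?_ (fun _ _ _ h => h) fun a σ₄ _ _ f₄ h7 i₄ => ?_)
      fun σ₄ f₄ i₄ => Spec.block ?_ ⟨?_, ?_, fun p => ?_⟩
    · rw [f₃.idx 6 (by decide), h6]
    · rw [f₃.idx 8 (by decide), i₂.1, add_zero]
    · rw [f₃.real 6 (by decide), f₃.asked rfl]
      exact i₂.2 p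
    · rw [f₃.idx 1 (by decide), f₂.idx 1 (by decide), f₁.idx 1 (by decide), hA]
    · have hp : 𝓜.offset s + a = 𝓜.position ⟨s, a⟩ := (𝓜.position_eq ⟨s, a⟩).symm
      obtain ⟨i8, i₄⟩ := i₄
      rw [hp] at i8 i₄
      refine (samplePair_spec (p := ⟨s, a⟩) (M := M) (m := m) (u := u) ?_ h7 i8 ?_ ?_ ?_
        ?_).mono (fun σ₅ _ h => ⟨h.1, ?_, fun p => ?_⟩)
      · rw [f₄.idx 6 (by decide), f₃.idx 6 (by decide), h6]
      · rw [f₄.idx 4 (by decide), f₃.idx 4 (by decide), f₂.idx 4 (by decide),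
          f₁.idx 4 (by decide), h4]
      · rw [f₄.real 9 (by decide), f₃.real 9 (by decide), f₂.real 9 (by decide),
          f₁.real 9 (by decide), h9]
      · rw [f₄.real 7 (by decide), f₃.real 7 (by decide), f₂.real 7 (by decide),
          f₁.real 7 (by decide)]
        exact hu
      · simpa using (i₄ ⟨s, a⟩).2
      · rw [h.2.1, ← hp, add_assoc]
      · rw [← add_assoc, hp, h.2.2.1, h.2.2.2, (i₄ p).1, (i₄ p).2]
        by_cases hps : p = ⟨s, a⟩
        · subst hps
          simp [apxUtility, sample_zero]
        · have h1 : 𝓜.position p ≠ 𝓜.position ⟨s, a⟩ := fun h => hps (𝓜.position_injective h)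
          have h2 : ¬ ((p.1 : ℕ) = s ∧ (p.2 : ℕ) = a) := fun h =>
            hps (𝓜.eq_of_val_eq h.1 h.2)
          have h3 : 𝓜.position p < 𝓜.position ⟨s, a⟩ + 1 ↔ 𝓜.position p < 𝓜.position ⟨s, a⟩ := by
            omega
          simp only [h1, h2, h3, if_false, and_self]
    · simp [Inside, Instr.cells, hn]
    · simp [f₄.idx 6 (by decide), f₃.idx 6 (by decide), h6]
    · simpa [offset_succ] using i₄.1
    · rw [offset_succ]
      exact i₄.2 p
  · rw [offset_numStates] at h
    exact ⟨fun p => by simpa [position_lt] using (h.2 p).1,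
      fun p => by simpa [position_lt] using (h.2 p).2⟩
  · exact le_of_eq (by ring)

/-! ### The main loop and the whole run -/

variable {v₀ : 𝓜.State → ℝ} {π₀ : 𝓜.Policy} {x : 𝓜.Pair → ℝ} {α δ : ℝ}

/-- The memory holds the constants that the iterations use. -/
structure HoldsConstants (𝓜 : DMDP) (x : 𝓜.Pair → ℝ) (α : ℝ) (M : ℕ) (σ : Config) : Prop where
  numStates : σ.idx 0 0 = 𝓜.numStates
  numActions : σ.idx 1 = toArray 𝓜.numActions
  iterCount : σ.idx 3 0 = 𝓜.iterCount
  sampleCount : σ.idx 4 0 = M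
  discount : σ.real 0 0 = 𝓜.γ
  reward : σ.real 4 = 𝓜.pairArray fun p => 𝓜.reward p.1 p.2
  offset : σ.real 5 = 𝓜.pairArray x
  sampleCountReal : σ.real 9 0 = M
  threshold : σ.real 11 0 = (1 - 𝓜.γ) * α
  shift : σ.real 13 0 = (1 - 𝓜.γ) * α / 8

lemma HoldsConstants.of_frame {M q k : ℕ} {DI DR : Finset ℕ} {σ' : Config}
    (h : 𝓜.HoldsConstants x α M σ) (hf : Frame 𝓜.Atot DI DR q k σ σ')
    (hI : Disjoint {0, 1, 3, 4} DI) (hR : Disjoint {0, 4, 5, 9, 11, 13} DR) :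
    𝓜.HoldsConstants x α M σ' := by
  simp only [Finset.disjoint_insert_left, Finset.disjoint_singleton_left] at hI hR
  obtain ⟨i0, i1, i3, i4⟩ := hI
  obtain ⟨r0, r4, r5, r9, r11, r13⟩ := hR
  obtain ⟨h1, h2, h3, h4, h5, h6, h7, h8, h9, h10⟩ := h
  constructor
  · rwa [hf.idx 0 i0]
  · rwa [hf.idx 1 i1]
  · rwa [hf.idx 3 i3]
  · rwa [hf.idx 4 i4]
  · rwa [hf.real 0 r0]
  · rwa [hf.real 4 r4]
  · rwa [hf.real 5 r5]
  · rwa [hf.real 9 r9]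
  · rwa [hf.real 11 r11]
  · rwa [hf.real 13 r13]

/-- The memory holds the variables of the algorithm after `ℓ` iterations. -/
structure HoldsIterate (𝓜 : DMDP) (I : 𝓜.Iterate) (m : ℕ) (σ : Config) : Prop where
  v : ∀ s : 𝓜.State, σ.real 3 s = I.v s
  π : ∀ s : 𝓜.State, σ.idx 2 s = I.π s
  g : ∀ p, σ.real 6 (𝓜.position p) = I.g p
  gHat : ∀ p, σ.real 6 (𝓜.position p) - σ.real 12 0 = I.gHat p
  asked : ∀ p : 𝓜.Pair, σ.asked p.1 p.2 = m

/-- `gHat` is not stored as a vector: it is `g` minus the scalar in real array `12`. The final copy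
into that cell installs the shift `(1 - γ) α / 8`, so the first iteration can run with shift zero
and later ones with the true shift. -/
lemma iterate_spec {M ℓ : ℕ} {I : 𝓜.Iterate} (hM : 0 < M) (hc : 𝓜.HoldsConstants x α M σ)
    (hi : 𝓜.HoldsIterate I (ℓ * M) σ) (h5 : σ.idx 5 0 = ℓ) :
    Spec (𝓜.oracle ω) 𝓜.Atot iterate {2, 5, 6, 7, 8, 9, 10, 11} {3, 6, 7, 12, 14, 15, 16, 20}
      (M * 𝓜.Atot) (50 * (M * 𝓜.Atot)) σ fun σ' => σ'.idx 5 0 = ℓ + 1 ∧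
        𝓜.HoldsIterate (𝓜.iteration 𝓜.firstMaximizer x α M ω ℓ I) ((ℓ + 1) * M) σ' := by
  have hn := 𝓜.Atot_pos
  set J := 𝓜.iteration 𝓜.firstMaximizer x α M ω ℓ I with hJ
  refine Spec.seq (q₂ := M * 𝓜.Atot) (k₂ := (4 * M + 12) * 𝓜.Atot + 5)
    (DI₂ := {5, 6, 7, 8, 9, 10}) (DR₂ := {6, 12, 16})
    (updateStates_spec (ℓ := ℓ) (M := M) (ω := ω) hc.numStates hc.numActions hc.discount
      hc.reward hc.offset hc.threshold hi.v hi.π hi.gHat) (fun σ₁ f₁ i₁ => ?_) (by decide)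
    (by decide) (by omega) ?_
  · have hc₁ := hc.of_frame f₁ (by decide) (by decide)
    refine Spec.seq (DI₂ := {5}) (DR₂ := {12}) (q₂ := 0) (k₂ := 2)
      (updateEstimates_spec (u := J.v - I.v) (g := I.g) (m := ℓ * M) hc₁.numStates
        hc₁.numActions hc₁.sampleCount hc₁.sampleCountReal (fun s => (i₁ s).2.2) (fun p => ?_)
        fun p => ?_) fun σ₂ f₂ i₂ => Spec.block ?_ ?_
    · rw [f₁.real 6 (by decide), hi.g]
    · rw [f₁.asked rfl, hi.asked]
    · simp [Inside, Instr.cells, Finset.union_subset_iff, hn]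
    · have hc₂ := hc₁.of_frame f₂ (by decide) (by decide)
      have e6 : ∀ p, σ₂.real 6 (𝓜.position p) = J.g p := i₂.1
      refine ⟨?_, fun s => ?_, fun s => ?_, fun p => ?_, fun p => ?_, fun p => ?_⟩
      · simp [f₂.idx 5 (by decide), f₁.idx 5 (by decide), h5]
      · simp [f₂.real 3 (by decide), i₁, hJ]
      · simp [f₂.idx 2 (by decide), i₁, hJ]
      · simp [e6]
      · simp [e6, hc₂.shift, hJ, iteration]
      · rw [add_mul, one_mul]
        exact i₂.2 p
  -- The constant `50` is the value of this cost bound at `M = Atot = 1`; otherwise there is slack.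
  · have : 𝓜.Atot ≤ M * 𝓜.Atot := Nat.le_mul_of_pos_left _ hM
    have : (4 * M + 12) * 𝓜.Atot = 4 * (M * 𝓜.Atot) + 12 * 𝓜.Atot := by ring
    omega

/-- The two rounding loops are given the unrounded `L` and `M` as targets, hence the linear cost.
The initial zeros of the start configuration serve as starting values of the counters; the shared
real counter is reset between the loops and ends up holding `M`. -/
lemma setup_spec {O : ℕ → ℕ → ℕ → ℕ} :
    Spec O 𝓜.Atot setup {3, 4, 6, 7} {8, 9, 10, 11, 13, 15, 17, 18, 19} 0
      (3 * 𝓜.iterCount + 8 * 𝓜.Atot + 3 * 𝓜.sampleCount δ + 20)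
      (𝓜.startConfig v₀ π₀ x α δ) (𝓜.HoldsConstants x α (𝓜.sampleCount δ)) := by
  have hn := 𝓜.Atot_pos
  set σ := 𝓜.startConfig v₀ π₀ x α δ with hσ
  have s0 : σ.real 0 0 = 𝓜.γ := rfl
  have s1 : σ.real 1 0 = α := rfl
  have s2 : σ.real 2 0 = δ := rfl
  refine Spec.seq (DI₁ := ∅) (DR₁ := {8, 10, 11, 13, 15, 19}) (q₁ := 0) (k₁ := 7)
    (DI₂ := {3, 4, 6, 7}) (DR₂ := {9, 10, 15, 17, 18}) (q₂ := 0)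
    (k₂ := 3 * 𝓜.iterCount + 8 * 𝓜.Atot + 3 * 𝓜.sampleCount δ + 13)
    (Q₁ := fun σ' => σ'.real 8 0 = 1 ∧ σ'.real 11 0 = (1 - 𝓜.γ) * α ∧
      σ'.real 13 0 = (1 - 𝓜.γ) * α / 8 ∧ σ'.real 10 0 = Real.log 8 * (1 - 𝓜.γ)⁻¹)
    (Spec.block ?_ ?_) fun σ₁ f₁ ⟨a8, a11, a13, a10⟩ => ?_
  · simp [Inside, Instr.cells, Finset.union_subset_iff, hn]
  · simp [ROp.eval, s0, s1, div_eq_mul_inv]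
  refine Spec.seq (DI₂ := {4, 6, 7}) (DR₂ := {9, 10, 15, 17, 18}) (q₂ := 0)
    (k₂ := 8 * 𝓜.Atot + 3 * 𝓜.sampleCount δ + 12)
    (ceilLoop_spec hn (by norm_num) a8 ?_ a10 ?_) (fun σ₂ f₂ b => ?_) (by decide) (by decide)
    (by omega) (by change 3 * 𝓜.iterCount + 1 + _ ≤ _; omega)
  · rw [f₁.real 9 (by decide)]; rfl
  · rw [f₁.idx 3 (by decide)]; rfl
  change σ₂.idx 3 0 = 𝓜.iterCount ∧ σ₂.real 9 0 = 𝓜.iterCount at b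
  refine Spec.seq (DI₁ := {6}) (DR₁ := {18}) (q₁ := 0) (k₁ := 2)
    (DI₂ := {4, 6, 7}) (DR₂ := {9, 10, 15, 17}) (q₂ := 0)
    (k₂ := 8 * 𝓜.Atot + 3 * 𝓜.sampleCount δ + 10)
    (Q₁ := fun σ' => σ'.idx 6 0 = 0 ∧ σ'.real 18 0 = 𝓜.iterCount)
    (Spec.block ?_ ?_) fun σ₃ f₃ c => ?_
  · simp [Inside, Instr.cells, Finset.union_subset_iff, hn]
  · simp [b]
  have c8 : σ₃.real 8 0 = 1 := by rw [f₃.real 8 (by decide), f₂.real 8 (by decide), a8]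
  refine Spec.seq (DI₂ := {4}) (DR₂ := {9, 10, 15}) (q₂ := 0)
    (k₂ := 3 * 𝓜.sampleCount δ + 9) (countPairs_spec ?_ ?_ c.1 c8 ?_) fun σ₄ f₄ d => ?_
  · rw [f₃.idx 0 (by decide), f₂.idx 0 (by decide), f₁.idx 0 (by decide)]; rfl
  · rw [f₃.idx 1 (by decide), f₂.idx 1 (by decide), f₁.idx 1 (by decide)]; rfl
  · rw [f₃.real 17 (by decide), f₂.real 17 (by decide), f₁.real 17 (by decide)]; rfl
  have d8 : σ₄.real 8 0 = 1 := by rw [f₄.real 8 (by decide), c8]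
  have d18 : σ₄.real 18 0 = 𝓜.iterCount := by rw [f₄.real 18 (by decide), c.2]
  have d2 : σ₄.real 2 0 = δ := by
    rw [f₄.real 2 (by decide), f₃.real 2 (by decide), f₂.real 2 (by decide),
      f₁.real 2 (by decide), s2]
  refine Spec.seq (DI₁ := ∅) (DR₁ := {9, 10, 15}) (q₁ := 0) (k₁ := 8)
    (DI₂ := {4}) (DR₂ := {9}) (q₂ := 0) (k₂ := 3 * 𝓜.sampleCount δ + 1)
    (Q₁ := fun σ' => σ'.real 8 0 = 1 ∧ σ'.real 9 0 = 0 ∧ σ'.real 10 0 =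
      (𝓜.iterCount : ℝ) * 2 ^ 8 * Real.log (2 * (𝓜.Atot : ℝ) / δ))
    (Spec.block ?_ ?_) fun σ₅ f₅ e => (ceilLoop_spec hn (by norm_num) e.1 e.2.1 e.2.2 ?_).mono
      (fun σ₆ f₆ h => ?_) subset_rfl subset_rfl le_rfl le_rfl
  · simp [Inside, Instr.cells, Finset.union_subset_iff, hn]
  · simp [ROp.eval, d8, d18, d2, d]
    norm_num
  · rw [f₅.idx 4 (by decide), f₄.idx 4 (by decide), f₃.idx 4 (by decide), f₂.idx 4 (by decide),
      f₁.idx 4 (by decide)]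
    rfl
  · have fi : ∀ a ∉ ({3, 4, 6, 7} : Finset ℕ), σ₆.idx a = σ.idx a := fun a ha => by
      simp only [Finset.mem_insert, Finset.mem_singleton, not_or] at ha
      rw [f₆.idx a (by simp [ha]), f₅.idx a (by simp), f₄.idx a (by simp [ha]),
        f₃.idx a (by simp [ha]), f₂.idx a (by simp [ha]), f₁.idx a (by simp)]
    have fr : ∀ a ∉ ({8, 9, 10, 11, 13, 15, 17, 18, 19} : Finset ℕ), σ₆.real a = σ.real a :=
      fun a ha => by
        simp only [Finset.mem_insert, Finset.mem_singleton, not_or] at ha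
        rw [f₆.real a (by simp [ha]), f₅.real a (by simp [ha]), f₄.real a (by simp [ha]),
          f₃.real a (by simp [ha]), f₂.real a (by simp [ha]), f₁.real a (by simp [ha])]
    constructor
    · rw [fi 0 (by decide)]; rfl
    · rw [fi 1 (by decide)]; rfl
    · rw [f₆.idx 3 (by decide), f₅.idx 3 (by decide), f₄.idx 3 (by decide),
        f₃.idx 3 (by decide), b.1]
    · exact h.1
    · rw [fr 0 (by decide), s0]
    · rw [fr 4 (by decide)]; rfl
    · rw [fr 5 (by decide)]; rfl
    · exact h.2
    · rw [f₆.real 11 (by decide), f₅.real 11 (by decide), f₄.real 11 (by decide),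
        f₃.real 11 (by decide), f₂.real 11 (by decide), a11]
    · rw [f₆.real 13 (by decide), f₅.real 13 (by decide), f₄.real 13 (by decide),
        f₃.real 13 (by decide), f₂.real 13 (by decide), a13]

lemma program_spec (h0 : 0 < δ) (h1 : δ < 1) :
    ∃ σ : Config, Exec (𝓜.oracle ω) program (𝓜.startConfig v₀ π₀ x α δ) σ ∧
      𝓜.IsOutput σ (𝓜.truncatedVRVI 𝓜.firstMaximizer v₀ π₀ x α δ ω).1
        (𝓜.truncatedVRVI 𝓜.firstMaximizer v₀ π₀ x α δ ω).2 ∧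
      σ.queries ≤ 𝓜.Atot * 𝓜.sampleCount δ * 𝓜.iterCount ∧
      σ.time ≤ 100 * (𝓜.Atot * 𝓜.sampleCount δ * 𝓜.iterCount) ∧
      σ.touched.card ≤ 100 * 𝓜.Atot := by
  have hn := 𝓜.Atot_pos
  have hM := 𝓜.sampleCount_pos h0 h1
  have hL := 𝓜.iterCount_pos
  set M := 𝓜.sampleCount δ with hMdef
  set L := 𝓜.iterCount with hLdef
  have spec : Spec (𝓜.oracle ω) 𝓜.Atot program {2, 3, 4, 5, 6, 7, 8, 9, 10, 11}
      {3, 6, 7, 8, 9, 10, 11, 12, 13, 14, 15, 16, 17, 18, 19, 20} (L * (M * 𝓜.Atot))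
      (3 * L + 8 * 𝓜.Atot + 3 * M + 20 + (L * (50 * (M * 𝓜.Atot) + 1) + 1))
      (𝓜.startConfig v₀ π₀ x α δ) fun σ =>
        𝓜.HoldsIterate (𝓜.iterates 𝓜.firstMaximizer v₀ π₀ x α M ω L) (L * M) σ := by
    refine Spec.seq (q₂ := L * (M * 𝓜.Atot))
      (k₂ := L * (50 * (M * 𝓜.Atot) + 1) + 1) setup_spec fun σ₁ f₁ hc => (Spec.loop
      (DI := {2, 5, 6, 7, 8, 9, 10, 11}) (DR := {3, 6, 7, 12, 14, 15, 16, 20})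
      (fun _ => M * 𝓜.Atot) (fun _ => 50 * (M * 𝓜.Atot)) L (fun ℓ σ' => σ'.idx 5 0 = ℓ ∧
        𝓜.HoldsIterate (𝓜.iterates 𝓜.firstMaximizer v₀ π₀ x α M ω ℓ) (ℓ * M) σ')
      ⟨?_, fun s => ?_, fun s => ?_, fun p => ?_, fun p => ?_, fun p => ?_⟩ ?_ ?_ ?_ ?_).mono
      (fun _ _ h => h.2) subset_rfl subset_rfl (le_of_eq (by simp)) (le_of_eq (by simp))
    · rw [f₁.idx 5 (by decide)]; rfl
    · rw [f₁.real 3 (by decide)]; exact toArray_of_lt v₀ s.2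
    · rw [f₁.idx 2 (by decide)]; exact toArray_of_lt (fun s => (π₀ s : ℕ)) s.2
    · rw [f₁.real 6 (by decide)]; rfl
    · rw [f₁.real 6 (by decide), f₁.real 12 (by decide)]; exact sub_zero 0
    · rw [f₁.asked rfl, zero_mul]; rfl
    · intro ℓ _ σ' _ _
      simp [hn]
    · intro ℓ hℓ σ' hf hi
      have hc' := hc.of_frame hf (by decide) (by decide)
      refine ⟨by simp [hi.1, hc'.iterCount, ← hLdef, hℓ], ?_⟩
      have hcells : (Test.iLt (.scalar 5) (.scalar 3)).cells σ' ⊆ workspace 𝓜.Atot := by simp [hn]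
      exact iterate_spec hM (hc'.of_frame (frame_charge (DI := ∅) (DR := ∅) hcells)
        (by decide) (by decide)) ⟨hi.2.v, hi.2.π, hi.2.g, hi.2.gHat, hi.2.asked⟩ hi.1
    · intro σ' hf hi
      have hc' := hc.of_frame hf (by decide) (by decide)
      simp [hi.1, hc'.iterCount, ← hLdef]
    · exact fun σ' cells h => ⟨h.1, h.2.v, h.2.π, h.2.g, h.2.gHat, h.2.asked⟩
  obtain ⟨σ, hexec, hf, hi⟩ := spec
  have hN : 𝓜.Atot * M * L = L * (M * 𝓜.Atot) := by ring
  -- As `L`, `M` and `Atot` are positive, each is at most their product, and so is `1`. The setup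
  -- cost and loop overhead are thus absorbed, for a total of at most `86` times the product.
  have b1 : L ≤ L * (M * 𝓜.Atot) := Nat.le_mul_of_pos_right _ (by positivity)
  have b2 : M * 𝓜.Atot ≤ L * (M * 𝓜.Atot) := Nat.le_mul_of_pos_left _ hL
  have b3 : M ≤ M * 𝓜.Atot := Nat.le_mul_of_pos_right _ hn
  have b4 : 𝓜.Atot ≤ M * 𝓜.Atot := Nat.le_mul_of_pos_left _ hM
  refine ⟨σ, hexec, fun s => ⟨hi.v s, hi.π s⟩, ?_, ?_, ?_⟩
  · have := hf.queries
    rw [hN]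
    exact this.trans_eq (Nat.zero_add _)
  · have h2 := hf.time
    have h3 : (𝓜.startConfig v₀ π₀ x α δ).time = 0 := rfl
    have h4 : L * (50 * (M * 𝓜.Atot) + 1) = 50 * (L * (M * 𝓜.Atot)) + L := by ring
    rw [hN]
    omega
  · have h2 := Finset.card_le_card (hf.touched (Finset.empty_subset _))
    have h3 := card_workspace_le 𝓜.Atot
    omega

end DMDP

end

theorem corollary2p3 :
    -- accuracy
    (∀ (𝓜 : DMDP) (am : 𝓜.SelectionRule) (v₀ : 𝓜.State → ℝ) (π₀ : 𝓜.Policy)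
        (x β : 𝓜.Pair → ℝ) (α δ : ℝ)
        (Ω : Type*) [MeasurableSpace Ω] (μ : Measure Ω) [IsProbabilityMeasure μ]
        (X : 𝓜.Pair → ℕ → Ω → 𝓜.State),
      𝓜.IsArgmaxRule am →
      0 < δ → δ < 1 →
      (∀ p, 0 ≤ β p) →
      (∀ p, 𝓜.utility v₀ p - β p ≤ x p ∧ x p ≤ 𝓜.utility v₀ p) →
      IsUnderestimate α v₀ 𝓜.optimalValue →
      (∀ s, v₀ s ≤ 𝓜.policyOp π₀ v₀ s) →
      𝓜.IsGenerativeModel μ X →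
      1 - δ ≤ μ.real {ω |
        let out := 𝓜.truncatedVRVI am v₀ π₀ x α δ (fun p j => X p j ω)
        let v := out.1
        let π := out.2
        (∀ s, 0 ≤ 𝓜.optimalValue s - v s) ∧
        (∀ πs : 𝓜.Policy, 𝓜.IsOptimalPolicy πs →
          let ξ : 𝓜.State → ℝ := fun s => 𝓜.γ * ((1 - 𝓜.γ) / 4 * α + β ⟨s, πs s⟩)
          ∀ s, 𝓜.optimalValue s - v s ≤
            𝓜.γ ^ 𝓜.iterCount * α + ((1 - 𝓜.γ • 𝓜.policyMatrix πs)⁻¹.mulVec ξ) s) ∧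
        (∀ s, v s ≤ 𝓜.policyOp π v s) ∧
        (β = 0 → ∀ s, 𝓜.optimalValue s - v s ≤ α / 2)}) ∧
    -- implementation: one program and one constant for all inputs
    (∃ (prog : RealRAM.Prog) (C : ℕ), ∀ 𝓜 : DMDP, ∃ am : 𝓜.SelectionRule, 𝓜.IsArgmaxRule am ∧
      ∀ (v₀ : 𝓜.State → ℝ) (π₀ : 𝓜.Policy) (x : 𝓜.Pair → ℝ) (α δ : ℝ) (ω : 𝓜.Tape),
        0 ≤ α → 0 < δ → δ < 1 →
        ∃ σ : RealRAM.Config,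
          RealRAM.Exec (𝓜.oracle ω) prog (𝓜.startConfig v₀ π₀ x α δ) σ ∧
          𝓜.IsOutput σ (𝓜.truncatedVRVI am v₀ π₀ x α δ ω).1
            (𝓜.truncatedVRVI am v₀ π₀ x α δ ω).2 ∧
          σ.queries ≤ 𝓜.Atot * 𝓜.sampleCount δ * 𝓜.iterCount ∧
          σ.time ≤ C * (𝓜.Atot * 𝓜.sampleCount δ * 𝓜.iterCount) ∧
          σ.touched.card ≤ C * 𝓜.Atot) := by
  refine ⟨fun 𝓜 am v₀ π₀ x β α δ Ω _ μ _ X ham h0 h1 hβ hx hv hπ hX =>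
    hX.le_measureReal_output am v₀ π₀ x α ham h0 h1 hβ hx hv hπ,
    RealRAM.program, 100, fun 𝓜 => ⟨𝓜.firstMaximizer, 𝓜.isArgmaxRule_firstMaximizer,
      fun v₀ π₀ x α δ ω _ h0 h1 => DMDP.program_spec h0 h1⟩⟩
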